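/- Let $d$ be a natural number and let $\mathbb{G}$ denote the Bohr compactification of $\mathbb{R}^d$: the closure of the image of $\mathbb{R}^d$ under $x\mapsto(e^{2\pi i\lambda\cdot x})_{\lambda\in\mathbb{R}^d}$ in the product of circles indexed by $\lambda\in\mathbb{R}^d$. It is a compact abelian group; let $\mathfrak{m}$ be its Haar measure with $\mathfrak m(\mathbb G)=1$, and regard $\mathbb{R}^d$ as mapped into $\mathbb{G}$. Partial derivatives on $(0,\infty)\times\mathbb{G}$ are $\partial_t\phi(t,\omega)=\lim_{h\to0}\frac{\phi(t+h,\omega)-\phi(t,\omega)}{h}$ and $\partial_{x_i}\phi(t,\omega)=\lim_{h\to0}\frac{\phi(t,\omega+he_i)-\phi(t,\omega)}{h}$; $C_0^\infty((0,\infty)\times\mathbb{G})$ is the space of compactly supported real functions all of whose iterated partial derivatives exist and are continuous, and distributional derivatives on $(0,\infty)\times\mathbb{G}$ are taken by duality with these test functions with respect to $dt\,d\mathfrak{m}$. Let $f_i,A_{ij},\sigma_{ij}:\mathbb{R}\to\mathbb{R}$ $(1\le i,j\le d)$ be smooth, with $A_{ij}=A_{ji}$ and $A_{ij}'=\sum_{k=1}^d\sigma_{ik}\sigma_{jk}$.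 Consider $$\partial_tu+\nabla\cdot \mathbf f(u)=\sum_{i,j=1}^d\partial^2_{x_ix_j}A_{ij}(u)\ \text{ in }(0,\infty)\times\mathbb{G},\qquad u(0,\cdot)=u_0\in L^\infty(\mathbb{G}).\qquad(*)$$ For $\psi\in C(\mathbb{R})$ let $\beta_{ik}$ and $\beta_{ik}^\psi$ be primitives of $\sigma_{ik}$ and $\psi\sigma_{ik}$. An entropy solution of $(*)$ is a function $u\in L^\infty((0,\infty)\times\mathbb{G})$ such that 1. $\sum_{i}\partial_{x_i}\beta_{ik}(u)\in L^2((0,\infty)\times\mathbb{G})$ for $k=1,\dots,d$; 2. for every $\psi\in C(\mathbb{R})$ and every $k$, $\sum_i\partial_{x_i}\beta^\psi_{ik}(u)=\psi(u)\sum_i\partial_{x_i}\beta_{ik}(u)\in L^2((0,\infty)\times\mathbb{G})$; 3. for every convex $\eta\in C^2(\mathbb{R})$, with $q_i'=\eta' f_i'$ and $r_{ij}'=\eta'A_{ij}'$, $$\partial_t\eta(u)+\sum_i\partial_{x_i}q_i(u)-\sum_{i,j}\partial^2_{x_ix_j}r_{ij}(u)\le-\eta''(u)\sum_{k}\Big(\sum_{i}\partial_{x_i}\beta_{ik}(u)\Big)^2$$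 in the sense of distributions in $(0,\infty)\times\mathbb{G}$; 4. $\int_{\mathbb{G}}|u(t,\omega)-u_0(\omega)|\,d\mathfrak{m}(\omega)\to0$ as $t\to0+$ (essential limit in $t$). **Theorem.** For given $u_0$ there is at most one entropy solution of $(*)$, up to equality almost everywhere in $(0,\infty)\times\mathbb{G}$. More specifically, if $u$ and $v$ are entropy solutions with initial functions $u_0$ and $v_0$ in $L^\infty(\mathbb{G})$, then for a.e. $t>0$ $$\int_{\mathbb{G}}|u(t,\omega)-v(t,\omega)|\,d\mathfrak{m}(\omega)\le\int_{\mathbb{G}}|u_0(\omega)-v_0(\omega)|\,d\mathfrak{m}(\omega).$$ -/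

import Mathlib

open MeasureTheory Filter Topology
open scoped ContDiff

noncomputable section

namespace BohrParabolic

/-- The homomorphism from `ℝ^d` to the product of circles `∏_{l ∈ ℝ^d} ℝ/ℤ` whose `l`-th component
is the character `x ↦ l · x mod 1`, that is, `x ↦ e^{2πi l·x}`. -/
def charHom (d : ℕ) : (Fin d → ℝ) →+ ((Fin d → ℝ) → UnitAddCircle) where
  toFun x := fun l => ((l ⬝ᵥ x : ℝ) : UnitAddCircle)
  map_zero' := by
    funext l
    simp
  map_add' x y := by
    funext l
    simp [dotProduct_add]

/-- The Bohr compactification of `ℝ^d`: the closure of the image of `ℝ^d` in the product of circles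
indexed by all the characters of `ℝ^d`, a compact Hausdorff abelian group. Its continuous functions
restrict to `ℝ^d` as the uniform limits of trigonometric polynomials. -/
def BohrCompact (d : ℕ) : Type :=
  ↥((charHom d).range.topologicalClosure)

instance (d : ℕ) : AddCommGroup (BohrCompact d) :=
  inferInstanceAs (AddCommGroup ↥((charHom d).range.topologicalClosure))

instance (d : ℕ) : TopologicalSpace (BohrCompact d) :=
  inferInstanceAs (TopologicalSpace ↥((charHom d).range.topologicalClosure))

instance (d : ℕ) : IsTopologicalAddGroup (BohrCompact d) :=
  inferInstanceAs (IsTopologicalAddGroup ↥((charHom d).range.topologicalClosure))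

instance (d : ℕ) : T2Space (BohrCompact d) :=
  inferInstanceAs (T2Space ↥((charHom d).range.topologicalClosure))

instance (d : ℕ) : CompactSpace (BohrCompact d) :=
  isCompact_iff_compactSpace.mp (charHom d).range.isClosed_topologicalClosure.isCompact

/-- The Borel σ-algebra. -/
instance (d : ℕ) : MeasurableSpace (BohrCompact d) := borel _

instance (d : ℕ) : BorelSpace (BohrCompact d) := ⟨rfl⟩

/-- The canonical homomorphism of `ℝ^d` into its Bohr compactification. -/
def toBohr (d : ℕ) : (Fin d → ℝ) →+ BohrCompact d where
  toFun x := ⟨charHom d x, subset_closure ⟨x, rfl⟩⟩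
  map_zero' := Subtype.ext (map_zero (charHom d))
  map_add' x y := Subtype.ext (map_add (charHom d) x y)

theorem continuous_toBohr (d : ℕ) : Continuous (toBohr d) := by
  refine Continuous.subtype_mk (continuous_pi fun l => ?_) _
  exact (AddCircle.continuous_mk' (1 : ℝ)).comp
    (continuous_const.dotProduct continuous_id)

theorem denseRange_toBohr (d : ℕ) : DenseRange (toBohr d) := by
  intro w
  have hind : IsInducing (fun z : BohrCompact d => z.1) := IsInducing.subtypeVal
  rw [hind.closure_eq_preimage_closure_image]
  refine closure_mono ?_ w.2
  rintro _ ⟨x, rfl⟩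
  exact ⟨toBohr d x, ⟨x, rfl⟩, rfl⟩

/-- The Haar measure of the Bohr compactification, normalized to total mass `1`. -/
def haar (d : ℕ) : Measure (BohrCompact d) := Measure.addHaarMeasure ⊤

instance (d : ℕ) : (haar d).IsAddHaarMeasure :=
  inferInstanceAs (Measure.addHaarMeasure ⊤).IsAddHaarMeasure

instance (d : ℕ) : IsProbabilityMeasure (haar d) :=
  ⟨Measure.addHaarMeasure_self⟩

/-- The product of Lebesgue measure on `(0,∞)` and Haar measure, as a measure on `ℝ × BohrCompact d`
carried by `(0,∞) × BohrCompact d`. -/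
def spaceTime (d : ℕ) : Measure (ℝ × BohrCompact d) :=
  (volume.restrict (Set.Ioi (0 : ℝ))).prod (haar d)

variable {d : ℕ}

/-- The restriction of `φ` to the line through `p` in the time direction. -/
def lineT (φ : ℝ × BohrCompact d → ℝ) (p : ℝ × BohrCompact d) (h : ℝ) : ℝ :=
  φ (p.1 + h, p.2)

/-- The restriction of `φ` to the line through `p` in the direction of `e_i`. -/
def lineX (i : Fin d) (φ : ℝ × BohrCompact d → ℝ) (p : ℝ × BohrCompact d) (h : ℝ) : ℝ :=
  φ (p.1, p.2 + toBohr d (h • Pi.single i 1))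

/-- The partial derivative in time. -/
def dt (φ : ℝ × BohrCompact d → ℝ) (p : ℝ × BohrCompact d) : ℝ := deriv (lineT φ p) 0

/-- The `i`-th partial derivative in space. -/
def dx (i : Fin d) (φ : ℝ × BohrCompact d → ℝ) (p : ℝ × BohrCompact d) : ℝ :=
  deriv (lineX i φ p) 0

/-- `φ` is of class `C^k`: its partial derivatives up to order `k` exist everywhere and are
continuous. -/
def IsCk : ℕ → (ℝ × BohrCompact d → ℝ) → Prop
  | 0, φ => Continuous φ
  | k + 1, φ => Continuous φ ∧
      (∀ p, DifferentiableAt ℝ (lineT φ p) 0) ∧ IsCk k (dt φ) ∧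
      ∀ i, (∀ p, DifferentiableAt ℝ (lineX i φ p) 0) ∧ IsCk k (dx i φ)

/-- The test functions `C_0^∞((0,∞) × BohrCompact d)`, extended by zero to `t ≤ 0`. -/
structure IsTest (φ : ℝ × BohrCompact d → ℝ) : Prop where
  smooth : ∀ k, IsCk k φ
  compact : HasCompactSupport φ
  support : tsupport φ ⊆ Set.Ioi (0 : ℝ) ×ˢ Set.univ

/-- `∑ i, ∂_{x_i} (F i) = g` in the sense of distributions in `(0,∞) × BohrCompact d`. -/
def HasWeakDiv (F : Fin d → ℝ × BohrCompact d → ℝ) (g : ℝ × BohrCompact d → ℝ) : Prop :=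
  ∀ φ, IsTest φ →
    ∫ p, (∑ i, F i p * dx i φ p) ∂(spaceTime d) = -∫ p, g p * φ p ∂(spaceTime d)

/-- The primitive of `g` that vanishes at `0`. -/
def prim (g : ℝ → ℝ) (s : ℝ) : ℝ := ∫ r in (0 : ℝ)..s, g r

/-- The data of the equation `∂_t u + ∇·f(u) = ∇²:A(u)`: a smooth flux `f`, a smooth symmetric
matrix `A`, and a smooth square root `σ` of the derivative of `A`. -/
structure Coefficients (d : ℕ) where
  f : Fin d → ℝ → ℝ
  A : Fin d → Fin d → ℝ → ℝ
  σ : Fin d → Fin d → ℝ → ℝ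
  smooth_f : ∀ i, ContDiff ℝ ∞ (f i)
  smooth_A : ∀ i j, ContDiff ℝ ∞ (A i j)
  smooth_σ : ∀ i j, ContDiff ℝ ∞ (σ i j)
  symm_A : ∀ i j s, A i j s = A j i s
  deriv_A : ∀ i j s, deriv (A i j) s = ∑ k, σ i k s * σ j k s

/-- The primitive `β_{ik}^ψ` of `ψ σ_{ik}`; for `ψ = 1` it is `β_{ik}`. -/
def Coefficients.β (P : Coefficients d) (ψ : ℝ → ℝ) (i k : Fin d) : ℝ → ℝ :=
  prim fun s => ψ s * P.σ i k s

/-- The entropy flux `q_i`, with `q_i' = η' f_i'`. -/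
def Coefficients.q (P : Coefficients d) (η : ℝ → ℝ) (i : Fin d) : ℝ → ℝ :=
  prim fun s => deriv η s * deriv (P.f i) s

/-- The functions `r_{ij}`, with `r_{ij}' = η' A_{ij}'`. -/
def Coefficients.r (P : Coefficients d) (η : ℝ → ℝ) (i j : Fin d) : ℝ → ℝ :=
  prim fun s => deriv η s * deriv (P.A i j) s

/-- The entropy inequality
`∂_t η(u) + ∇·q(u) - ∑ ∂²_{x_i x_j} r_{ij}(u) ≤ -η''(u) ∑_k (g_k)²`
in the sense of distributions in `(0,∞) × BohrCompact d`. -/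
def EntropyInequality (P : Coefficients d) (u : ℝ × BohrCompact d → ℝ)
    (g : Fin d → ℝ × BohrCompact d → ℝ) (η : ℝ → ℝ) : Prop :=
  ∀ φ, IsTest φ → (∀ p, 0 ≤ φ p) →
    ∫ p, deriv (deriv η) (u p) * (∑ k, g k p ^ 2) * φ p ∂(spaceTime d) ≤
      ∫ p, (η (u p) * dt φ p + ∑ i, P.q η i (u p) * dx i φ p
        + ∑ i, ∑ j, P.r η i j (u p) * dx i (dx j φ) p) ∂(spaceTime d)

/-- `u` is an entropy solution of `∂_t u + ∇·f(u) = ∇²:A(u)` in `(0,∞) × BohrCompact d` with initial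
function `u₀`. The function `g k` is the distribution `∑ i, ∂_{x_i} β_{ik}(u)`, and the initial
condition is a limit over almost all `t`, since `u` is determined only almost everywhere. -/
def IsEntropySolution (P : Coefficients d) (u₀ : BohrCompact d → ℝ)
    (u : ℝ × BohrCompact d → ℝ) : Prop :=
  MemLp u₀ ⊤ (haar d) ∧ MemLp u ⊤ (spaceTime d) ∧
  (∃ g : Fin d → ℝ × BohrCompact d → ℝ,
    (∀ k, MemLp (g k) 2 (spaceTime d) ∧
      HasWeakDiv (fun i p => P.β (fun _ => 1) i k (u p)) (g k)) ∧
    (∀ ψ : ℝ → ℝ, Continuous ψ → ∀ k,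
      MemLp (fun p => ψ (u p) * g k p) 2 (spaceTime d) ∧
      HasWeakDiv (fun i p => P.β ψ i k (u p)) (fun p => ψ (u p) * g k p)) ∧
    (∀ η : ℝ → ℝ, ConvexOn ℝ Set.univ η → ContDiff ℝ 2 η → EntropyInequality P u g η)) ∧
  Tendsto (fun t => ∫ w, |u (t, w) - u₀ w| ∂(haar d)) (𝓝[>] (0 : ℝ) ⊓ ae volume) (𝓝 0)

end BohrParabolic

end

/-! The proof is Kruzhkov's doubling of variables, with the parabolic dissipation used to absorb the
second-order terms. Put η(r) = √(r² + δ²). The entropy inequality of u(t,x) with constant v(s,y) and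
that of v(s,y) with constant u(t,x) are tested with τ(t,s) ρ(x - y), integrated in the remaining
variables, and added. Let g_k and h_k be the dissipation functions of u and v. The dissipation is at
least 2 ∑_k ∫ η''(u - v) g_k h_k τ ρ. The chain rule, applied once in x and once in y, turns this
into second derivatives of ρ paired with the double primitive of η''(s - w) σ_ik(s) σ_jk(w)
(`IsSlabSolution.cross_double`).

Functions of u alone or of v alone pair to zero with spatial derivatives of ρ, because derivatives
have Haar mean zero. Modulo these, every spatial term is a double primitive of η''(s - w) H(s,w)
with H vanishing on the diagonal: f_i'(s) - f_i'(w) at first order, A_ij'(s) + A_ij'(w) - 2 ∑_k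
σ_jk(s) σ_ik(w) at second order. Since |r| η''(r) ≤ δ²/(r² + δ²), whose integral over the line is
πδ, such terms are O(δ) (`abs_regDouble_le`). Letting δ → 0 leaves only the time derivatives of τ
(`IsSlabSolution.kruzhkov`). As the group is compact with invariant measure, no cutoff in space is
needed.

The kernels ρ are trigonometric polynomials: they are stable under differentiation and translation,
and ρ(x - y) is measurable for the product σ-algebra because each character splits. Peaked ones
exist since characters separate points (`exists_trig_kernel`); together with the density of
continuous functions (`isContApprox_of_integrable`) they act as approximate identities in L¹ of a
slab.

With τ(t,s) = θ(t) κ(t - s) the time derivatives add up to θ'(t) κ(t - s). Concentrating κ and ρ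
gives ∫ θ'(t) ‖u(t) - v(t)‖₁ dt ≥ 0, and smoothed indicators θ make ‖u(t) - v(t)‖₁ nonincreasing for
a.e. t. The initial condition and the triangle inequality then give the contraction, of which
uniqueness is the case of equal initial data. -/

namespace BohrParabolic

/-! ### Trigonometric polynomials on the Bohr compactification -/

/-- The function `cos (2π ·)` on `ℝ/ℤ`. -/
noncomputable def circleCos (a : UnitAddCircle) : ℝ := (AddCircle.toCircle a : ℂ).re

theorem continuous_circleCos : Continuous circleCos :=
  Complex.continuous_re.comp (continuous_subtype_val.comp AddCircle.continuous_toCircle)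

theorem circleCos_coe (x : ℝ) : circleCos (x : UnitAddCircle) = Real.cos (2 * Real.pi * x) := by
  rw [circleCos, AddCircle.toCircle_apply_mk, Circle.coe_exp, Complex.exp_ofReal_mul_I_re,
    div_one]

theorem circleCos_neg (a : UnitAddCircle) : circleCos (-a) = circleCos a := by
  induction a using QuotientAddGroup.induction_on with
  | H x => rw [← AddCircle.coe_neg, circleCos_coe, circleCos_coe, mul_neg, Real.cos_neg]

theorem circleCos_le_one (a : UnitAddCircle) : circleCos a ≤ 1 := by
  induction a using QuotientAddGroup.induction_on with
  | H x => exact (circleCos_coe x).trans_le (Real.cos_le_one _)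

theorem neg_one_le_circleCos (a : UnitAddCircle) : -1 ≤ circleCos a := by
  induction a using QuotientAddGroup.induction_on with
  | H x => exact (Real.neg_one_le_cos _).trans_eq (circleCos_coe x).symm

theorem circleCos_zero : circleCos 0 = 1 := by
  have := circleCos_coe 0
  simpa using this

theorem circleCos_lt_one {a : UnitAddCircle} (ha : a ≠ 0) : circleCos a < 1 := by
  refine lt_of_le_of_ne (circleCos_le_one a) fun h => ha ?_
  induction a using QuotientAddGroup.induction_on with
  | H x =>
    erw [circleCos_coe, Real.cos_eq_one_iff] at h
    obtain ⟨n, hn⟩ := h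
    have hx : x = n := by
      have := Real.pi_pos
      field_simp at hn
      linarith
    subst hx
    exact (AddCircle.coe_eq_zero_iff (1 : ℝ)).2 ⟨n, by simp⟩

/-- The derivative of the cosine is a shifted cosine. -/
theorem hasDerivAt_circleCos (c : ℝ) (a : UnitAddCircle) :
    HasDerivAt (fun h : ℝ => circleCos (a + ((c * h : ℝ) : UnitAddCircle)))
      (2 * Real.pi * c * circleCos (a + ((1 / 4 : ℝ) : UnitAddCircle))) 0 := by
  induction a using QuotientAddGroup.induction_on with
  | H x =>
    have h1 : ∀ h : ℝ, circleCos (((x : ℝ) : UnitAddCircle) + ((c * h : ℝ) : UnitAddCircle)) =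
        Real.cos (2 * Real.pi * (x + c * h)) := fun h => by
      rw [← AddCircle.coe_add, circleCos_coe]
    have h2 : circleCos (((x : ℝ) : UnitAddCircle) + ((1 / 4 : ℝ) : UnitAddCircle)) =
        -Real.sin (2 * Real.pi * x) := by
      rw [← AddCircle.coe_add, circleCos_coe, ← Real.cos_add_pi_div_two]
      congr 1
      ring
    have h3 : HasDerivAt (fun h : ℝ => 2 * Real.pi * (x + c * h)) (2 * Real.pi * c) 0 := by
      have := (((hasDerivAt_id (0 : ℝ)).const_mul c).const_add x).const_mul (2 * Real.pi)
      simpa using this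
    have h4 := h3.cos
    refine (h4.congr_deriv ?_).congr_of_eventuallyEq (Eventually.of_forall h1)
    erw [h2]
    simp
    ring

variable {d : ℕ}

/-- The character of the Bohr compactification with frequency `l`. -/
def character (l : Fin d → ℝ) (w : BohrCompact d) : UnitAddCircle := w.1 l

theorem continuous_character (l : Fin d → ℝ) : Continuous (character l) :=
  (continuous_apply l).comp continuous_subtype_val

theorem character_add (l : Fin d → ℝ) (w z : BohrCompact d) :
    character l (w + z) = character l w + character l z := rfl

theorem character_neg (l : Fin d → ℝ) (w : BohrCompact d) :
    character l (-w) = -character l w := rfl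

theorem character_sub (l : Fin d → ℝ) (w z : BohrCompact d) :
    character l (w - z) = character l w - character l z := rfl

theorem character_zero (l : Fin d → ℝ) : character l (0 : BohrCompact d) = 0 := rfl

theorem character_toBohr (l x : Fin d → ℝ) :
    character l (toBohr d x) = ((l ⬝ᵥ x : ℝ) : UnitAddCircle) := rfl

theorem exists_character_ne_zero {w : BohrCompact d} (hw : w ≠ 0) : ∃ l, character l w ≠ 0 := by
  by_contra! h
  exact hw (Subtype.ext (funext h))

/-- Real trigonometric polynomials. -/
inductive IsTrig : (BohrCompact d → ℝ) → Prop
  | const (c : ℝ) : IsTrig fun _ => c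
  | cosine (l : Fin d → ℝ) (a : UnitAddCircle) : IsTrig fun w => circleCos (character l w + a)
  | add {b c : BohrCompact d → ℝ} : IsTrig b → IsTrig c → IsTrig fun w => b w + c w
  | mul {b c : BohrCompact d → ℝ} : IsTrig b → IsTrig c → IsTrig fun w => b w * c w

namespace IsTrig

variable {b : BohrCompact d → ℝ}

theorem continuous (hb : IsTrig b) : Continuous b := by
  induction hb with
  | const c => exact continuous_const
  | cosine l a => exact continuous_circleCos.comp ((continuous_character l).add continuous_const)
  | add _ _ h1 h2 => exact h1.add h2
  | mul _ _ h1 h2 => exact h1.mul h2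

theorem bounded (hb : IsTrig b) : ∃ C, ∀ w, |b w| ≤ C := by
  obtain ⟨C, hC⟩ := isCompact_univ.exists_bound_of_continuousOn hb.continuous.continuousOn
  exact ⟨C, fun w => hC w trivial⟩

theorem pow (hb : IsTrig b) (n : ℕ) : IsTrig fun w => b w ^ n := by
  induction n with
  | zero => simpa using IsTrig.const 1
  | succ n ih => simpa only [pow_succ] using ih.mul hb

theorem const_mul (hb : IsTrig b) (c : ℝ) : IsTrig fun w => c * b w := (IsTrig.const c).mul hb

theorem comp_sub_const (hb : IsTrig b) (z : BohrCompact d) : IsTrig fun w => b (w - z) := by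
  induction hb with
  | const c => exact .const c
  | cosine l a =>
    convert IsTrig.cosine l (a - character l z) using 3 with w
    rw [character_sub]; abel
  | add _ _ h1 h2 => exact h1.add h2
  | mul _ _ h1 h2 => exact h1.mul h2

theorem comp_neg (hb : IsTrig b) : IsTrig fun w => b (-w) := by
  induction hb with
  | const c => exact .const c
  | cosine l a =>
    convert IsTrig.cosine l (-a) using 2 with w
    show circleCos (character l (-w) + a) = _
    rw [character_neg, ← circleCos_neg]; congr 1; abel
  | add _ _ h1 h2 => exact h1.add h2
  | mul _ _ h1 h2 => exact h1.mul h2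

/-- The convolution kernel of a trigonometric polynomial is measurable for the product
`σ`-algebra, although subtraction on the Bohr compactification is not. -/
theorem measurable_sub (hb : IsTrig b) :
    Measurable fun z : BohrCompact d × BohrCompact d => b (z.1 - z.2) := by
  induction hb with
  | const c => exact measurable_const
  | cosine l a =>
    have h1 : Measurable fun z : BohrCompact d × BohrCompact d => character l z.1 :=
      (continuous_character l).measurable.comp measurable_fst
    have h2 : Measurable fun z : BohrCompact d × BohrCompact d => character l z.2 :=
      (continuous_character l).measurable.comp measurable_snd
    exact continuous_circleCos.measurable.comp ((h1.sub h2).add_const a)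
  | add _ _ h1 h2 => exact h1.add h2
  | mul _ _ h1 h2 => exact h1.mul h2

end IsTrig

/-! ### Directional derivatives of trigonometric polynomials -/

/-- The directional derivative of a function on the Bohr compactification along `e_i`. -/
noncomputable def dirDeriv (i : Fin d) (b : BohrCompact d → ℝ) (w : BohrCompact d) : ℝ :=
  deriv (fun h : ℝ => b (w + toBohr d (h • Pi.single i 1))) 0

/-- Differentiating a cosine only shifts its phase by a quarter period and rescales it, so the class
of trigonometric polynomials is closed under differentiation. Arbitrary phases are allowed in
`IsTrig.cosine` for this reason. -/
theorem IsTrig.hasDerivAt_aux {b : BohrCompact d → ℝ} (hb : IsTrig b) (i : Fin d) :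
    ∃ b', IsTrig b' ∧ ∀ w,
      HasDerivAt (fun h : ℝ => b (w + toBohr d (h • Pi.single i 1))) (b' w) 0 := by
  induction hb with
  | const c => exact ⟨_, .const 0, fun w => hasDerivAt_const _ _⟩
  | cosine l a =>
    refine ⟨_, (IsTrig.cosine l (a + ((1 / 4 : ℝ) : UnitAddCircle))).const_mul
      (2 * Real.pi * l i), fun w => ?_⟩
    have := hasDerivAt_circleCos (l i) (character l w + a)
    rw [add_assoc] at this
    refine this.congr_of_eventuallyEq (Eventually.of_forall fun h => ?_)
    simp only [character_add, character_toBohr, dotProduct_smul, dotProduct_single, smul_eq_mul,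
      mul_one]
    rw [mul_comm h]
    congr 1
    abel
  | @add b c hb hc h1 h2 =>
    obtain ⟨b1, hb1, hd1⟩ := h1
    obtain ⟨c1, hc1, hd2⟩ := h2
    exact ⟨_, hb1.add hc1, fun w => (hd1 w).add (hd2 w)⟩
  | @mul b c hb hc h1 h2 =>
    obtain ⟨b1, hb1, hd1⟩ := h1
    obtain ⟨c1, hc1, hd2⟩ := h2
    refine ⟨_, (hb1.mul hc).add (hb.mul hc1), fun w => ?_⟩
    have := (hd1 w).mul (hd2 w)
    simp only [zero_smul, map_zero, add_zero] at this
    exact this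

theorem IsTrig.hasDerivAt {b : BohrCompact d → ℝ} (hb : IsTrig b) (i : Fin d)
    (w : BohrCompact d) :
    HasDerivAt (fun h : ℝ => b (w + toBohr d (h • Pi.single i 1))) (dirDeriv i b w) 0 := by
  obtain ⟨b', -, h⟩ := hb.hasDerivAt_aux i
  exact (h w).differentiableAt.hasDerivAt

theorem IsTrig.dirDeriv {b : BohrCompact d → ℝ} (hb : IsTrig b) (i : Fin d) :
    IsTrig (dirDeriv i b) := by
  obtain ⟨b', hb', h⟩ := hb.hasDerivAt_aux i
  have : BohrParabolic.dirDeriv i b = b' := funext fun w => (h w).deriv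
  rwa [this]

theorem dirDeriv_comp_sub_const (i : Fin d) (b : BohrCompact d → ℝ) (z w : BohrCompact d) :
    dirDeriv i (fun w => b (w - z)) w = dirDeriv i b (w - z) := by
  simp only [dirDeriv, add_sub_right_comm]

theorem dirDeriv_comp_const_sub (i : Fin d) (b : BohrCompact d → ℝ) (z w : BohrCompact d) :
    dirDeriv i (fun w => b (z - w)) w = -dirDeriv i b (z - w) := by
  have h : ∀ h : ℝ, b (z - (w + toBohr d (h • Pi.single i 1))) =
      (fun h : ℝ => b (z - w + toBohr d (h • Pi.single i 1))) (-h) := fun h => by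
    simp only [neg_smul, map_neg]
    congr 1
    abel
  have key := deriv_comp_neg (fun h : ℝ => b (z - w + toBohr d (h • Pi.single i 1))) 0
  rw [neg_zero] at key
  unfold dirDeriv
  rw [← key]
  exact congrArg (fun f : ℝ → ℝ => deriv f 0) (funext h)

theorem IsTrig.comp_const_sub {b : BohrCompact d → ℝ} (hb : IsTrig b) (z : BohrCompact d) :
    IsTrig fun w => b (z - w) := by
  have := (hb.comp_neg).comp_sub_const z
  simpa using this

theorem dirDeriv_neg (i : Fin d) (b : BohrCompact d → ℝ) (w : BohrCompact d) :
    dirDeriv i (fun w => -b w) w = -dirDeriv i b w := by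
  simp only [dirDeriv]
  exact deriv.fun_neg

theorem integrable_of_continuous {b : BohrCompact d → ℝ} (hb : Continuous b) :
    Integrable b (haar d) := by
  rw [← integrableOn_univ]
  exact hb.continuousOn.integrableOn_compact isCompact_univ

/-- Derivatives have mean zero, by invariance of the Haar measure. -/
theorem integral_dirDeriv {b : BohrCompact d → ℝ} (hb : IsTrig b) (i : Fin d) :
    ∫ w, dirDeriv i b w ∂(haar d) = 0 := by
  set e : ℝ → BohrCompact d := fun h => toBohr d (h • Pi.single i 1) with he
  have hadd : ∀ h h' : ℝ, e (h + h') = e h + e h' := fun h h' => by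
    simp only [he, add_smul, map_add]
  have hder : ∀ (w : BohrCompact d) (x : ℝ),
      HasDerivAt (fun h : ℝ => b (w + e h)) (dirDeriv i b (w + e x)) x := by
    intro w x
    have h1 := hb.hasDerivAt i (w + e x)
    have h2 : HasDerivAt (fun h : ℝ => b (w + e x + e (h - x))) (dirDeriv i b (w + e x)) x := by
      have h3 : HasDerivAt (fun h : ℝ => h - x) 1 x := (hasDerivAt_id x).sub_const x
      have h1' : HasDerivAt (fun h : ℝ => b (w + e x + e h)) (dirDeriv i b (w + e x)) (x - x) := by
        simpa [he] using h1
      simpa [Function.comp_def] using HasDerivAt.comp (h := fun h : ℝ => h - x) x h1' h3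
    refine h2.congr_of_eventuallyEq (Eventually.of_forall fun h => ?_)
    simp only [add_assoc, ← hadd]
    simp
  obtain ⟨C, hC⟩ := (hb.dirDeriv i).bounded
  have key := (hasDerivAt_integral_of_dominated_loc_of_deriv_le (μ := haar d) (s := Set.univ)
    (x₀ := (0 : ℝ)) (F := fun h w => b (w + e h)) (F' := fun h w => dirDeriv i b (w + e h))
    (bound := fun _ => C) univ_mem
    (Eventually.of_forall fun h =>
      (hb.continuous.comp (continuous_add_const _)).measurable.aestronglyMeasurable)
    (integrable_of_continuous (hb.continuous.comp (continuous_add_const _)))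
    ((hb.dirDeriv i).continuous.comp (continuous_add_const _)).measurable.aestronglyMeasurable
    (Eventually.of_forall fun w x _ => hC _) (integrable_const _)
    (Eventually.of_forall fun w x _ => hder w x)).2
  have hconst : (fun h : ℝ => ∫ w, b (w + e h) ∂(haar d)) = fun _ => ∫ w, b w ∂(haar d) :=
    funext fun h => integral_add_right_eq_self b (e h)
  rw [hconst] at key
  have := key.unique (hasDerivAt_const _ _)
  simpa [he] using this

/-! ### Products of a function of time and a trigonometric polynomial as test functions -/

theorem dt_mul (a : ℝ → ℝ) (b : BohrCompact d → ℝ) (p : ℝ × BohrCompact d) :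
    dt (fun p : ℝ × BohrCompact d => a p.1 * b p.2) p = deriv a p.1 * b p.2 := by
  simp only [dt]
  show deriv (fun h => a (p.1 + h) * b p.2) 0 = _
  rw [deriv_mul_const_field, deriv_comp_const_add (f := a)]
  simp

theorem dx_mul (i : Fin d) (a : ℝ → ℝ) (b : BohrCompact d → ℝ) (p : ℝ × BohrCompact d) :
    dx i (fun p : ℝ × BohrCompact d => a p.1 * b p.2) p = a p.1 * dirDeriv i b p.2 := by
  simp only [dx]
  show deriv (fun h : ℝ => a p.1 * b (p.2 + toBohr d (h • Pi.single i 1))) 0 = _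
  rw [deriv_const_mul_field]
  rfl

/-- Both kinds of partial derivative keep the product form, replacing `a` by `deriv a` or `b` by
`dirDeriv i b`; hence the induction runs over all `a` and `b` at once. -/
theorem isCk_mul (k : ℕ) {a : ℝ → ℝ} {b : BohrCompact d → ℝ} (ha : ContDiff ℝ ∞ a)
    (hb : IsTrig b) : IsCk k fun p : ℝ × BohrCompact d => a p.1 * b p.2 := by
  induction k generalizing a b with
  | zero => exact (ha.continuous.comp continuous_fst).mul (hb.continuous.comp continuous_snd)
  | succ k ih =>
    refine ⟨(ha.continuous.comp continuous_fst).mul (hb.continuous.comp continuous_snd),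
      fun p => ?_, ?_, fun i => ⟨fun p => ?_, ?_⟩⟩
    · have h1 : DifferentiableAt ℝ (fun h : ℝ => a (p.1 + h)) 0 :=
        ((ha.differentiable (by simp)).comp (differentiable_id.const_add p.1)) 0
      exact h1.mul_const (b p.2)
    · rw [show dt (fun p : ℝ × BohrCompact d => a p.1 * b p.2) =
        fun p => deriv a p.1 * b p.2 from funext (dt_mul a b)]
      exact ih ((contDiff_infty_iff_deriv.1 ha).2) hb
    · exact ((hb.hasDerivAt i p.2).differentiableAt).const_mul (a p.1)
    · rw [show dx i (fun p : ℝ × BohrCompact d => a p.1 * b p.2) =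
        fun p => a p.1 * dirDeriv i b p.2 from funext (dx_mul i a b)]
      exact ih ha (hb.dirDeriv i)

/-- Only time has to be cut off, since the group is compact; `0 < α` keeps the closed support away
from `t = 0`. -/
theorem isTest_mul {a : ℝ → ℝ} {b : BohrCompact d → ℝ} {α β : ℝ} (hα : 0 < α)
    (ha : ContDiff ℝ ∞ a) (hb : IsTrig b) (hsupp : ∀ t, t ∉ Set.Icc α β → a t = 0) :
    IsTest fun p : ℝ × BohrCompact d => a p.1 * b p.2 := by
  have hK : IsCompact (Set.Icc α β ×ˢ (Set.univ : Set (BohrCompact d))) :=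
    isCompact_Icc.prod isCompact_univ
  have h0 : ∀ p : ℝ × BohrCompact d, p ∉ Set.Icc α β ×ˢ (Set.univ : Set (BohrCompact d)) →
      a p.1 * b p.2 = 0 := fun p hp => by
    rw [hsupp p.1 fun h => hp ⟨h, trivial⟩, zero_mul]
  refine ⟨fun k => isCk_mul k ha hb, HasCompactSupport.intro hK h0, ?_⟩
  refine (closure_minimal (fun p hp => ?_) hK.isClosed).trans
    (Set.prod_mono (fun t ht => lt_of_lt_of_le hα ht.1) subset_rfl)
  by_contra h
  exact hp (h0 p h)

/-! ### A smooth convex approximation of the absolute value -/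

/-- The approximation `√(r² + δ²)` of `|r|`. -/
noncomputable def absReg (δ r : ℝ) : ℝ := √(r ^ 2 + δ ^ 2)

/-- The derivative of `absReg δ`. -/
noncomputable def absRegD (δ r : ℝ) : ℝ := r / √(r ^ 2 + δ ^ 2)

/-- The second derivative of `absReg δ`. -/
noncomputable def absRegDD (δ r : ℝ) : ℝ := δ ^ 2 / ((r ^ 2 + δ ^ 2) * √(r ^ 2 + δ ^ 2))

section absReg

variable {δ : ℝ}

theorem sq_add_sq_pos_of_pos (hδ : 0 < δ) (r : ℝ) : 0 < r ^ 2 + δ ^ 2 := by positivity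

theorem hasDerivAt_absReg (hδ : 0 < δ) (r : ℝ) : HasDerivAt (absReg δ) (absRegD δ r) r := by
  have h := ((hasDerivAt_pow 2 r).add_const (δ ^ 2)).sqrt (sq_add_sq_pos_of_pos hδ r).ne'
  refine h.congr_deriv ?_
  simp only [absRegD, Nat.cast_ofNat]
  field_simp
  ring

theorem hasDerivAt_absRegD (hδ : 0 < δ) (r : ℝ) : HasDerivAt (absRegD δ) (absRegDD δ r) r := by
  have h0 := sq_add_sq_pos_of_pos hδ r
  have hs : 0 < √(r ^ 2 + δ ^ 2) := Real.sqrt_pos.2 h0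
  have h := (hasDerivAt_id r).div (hasDerivAt_absReg hδ r) (by simpa [absReg] using hs.ne')
  refine h.congr_deriv ?_
  simp only [absReg, absRegD, absRegDD, id]
  have h2 : √(r ^ 2 + δ ^ 2) ^ 2 = r ^ 2 + δ ^ 2 := Real.sq_sqrt h0.le
  rw [h2]
  field_simp
  rw [h2]
  ring

theorem continuous_absReg : Continuous (absReg δ) := by unfold absReg; fun_prop

theorem continuous_absRegD (hδ : 0 < δ) : Continuous (absRegD δ) :=
  continuous_iff_continuousAt.2 fun r => (hasDerivAt_absRegD hδ r).continuousAt

theorem continuous_absRegDD (hδ : 0 < δ) : Continuous (absRegDD δ) := by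
  unfold absRegDD
  refine continuous_const.div (by fun_prop) fun r => ?_
  have := sq_add_sq_pos_of_pos hδ r
  positivity

theorem absRegDD_nonneg (r : ℝ) : 0 ≤ absRegDD δ r := by unfold absRegDD; positivity

theorem absReg_neg (r : ℝ) : absReg δ (-r) = absReg δ r := by simp [absReg]

theorem absRegDD_neg (r : ℝ) : absRegDD δ (-r) = absRegDD δ r := by simp [absRegDD]

theorem abs_le_absReg (r : ℝ) : |r| ≤ absReg δ r := by
  rw [← Real.sqrt_sq_eq_abs]
  exact Real.sqrt_le_sqrt (by nlinarith [sq_nonneg δ])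

theorem absReg_le (hδ : 0 < δ) (r : ℝ) : absReg δ r ≤ |r| + δ := by
  refine Real.sqrt_le_iff.2 ⟨by positivity, ?_⟩
  nlinarith [sq_abs r, mul_nonneg (abs_nonneg r) hδ.le]

/-- The estimate behind every limit δ → 0: η'' has mass of order one near zero, but one factor |r|
reduces it to a function of integral πδ. -/
theorem abs_mul_absRegDD_le (hδ : 0 < δ) (r : ℝ) :
    |r| * absRegDD δ r ≤ δ ^ 2 / (r ^ 2 + δ ^ 2) := by
  have h0 := sq_add_sq_pos_of_pos hδ r
  have hs : 0 < √(r ^ 2 + δ ^ 2) := Real.sqrt_pos.2 h0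
  have h1 : |r| ≤ √(r ^ 2 + δ ^ 2) := abs_le_absReg r
  unfold absRegDD
  rw [← mul_div_assoc, div_le_div_iff₀ (by positivity) h0]
  nlinarith [mul_le_mul_of_nonneg_right h1 (by positivity : 0 ≤ δ ^ 2 * (r ^ 2 + δ ^ 2))]

theorem deriv_absReg_sub (hδ : 0 < δ) (k : ℝ) :
    deriv (fun r => absReg δ (r - k)) = fun r => absRegD δ (r - k) :=
  funext fun r => ((hasDerivAt_absReg hδ (r - k)).comp_sub_const r k).deriv

theorem deriv_absRegD_sub (hδ : 0 < δ) (k : ℝ) :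
    deriv (fun r => absRegD δ (r - k)) = fun r => absRegDD δ (r - k) :=
  funext fun r => ((hasDerivAt_absRegD hδ (r - k)).comp_sub_const r k).deriv

theorem contDiff_absReg_sub (hδ : 0 < δ) (k : ℝ) : ContDiff ℝ 2 fun r => absReg δ (r - k) := by
  unfold absReg
  refine ContDiff.sqrt (by fun_prop) fun r => ?_
  exact (sq_add_sq_pos_of_pos hδ _).ne'

theorem convexOn_absReg_sub (hδ : 0 < δ) (k : ℝ) :
    ConvexOn ℝ Set.univ fun r => absReg δ (r - k) := by
  refine convexOn_univ_of_deriv2_nonneg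
    (fun r => ((hasDerivAt_absReg hδ (r - k)).comp_sub_const r k).differentiableAt) ?_ fun r => ?_
  · rw [deriv_absReg_sub hδ]
    exact fun r => ((hasDerivAt_absRegD hδ (r - k)).comp_sub_const r k).differentiableAt
  · simp only [Function.iterate_succ, Function.iterate_zero, Function.comp, id]
    rw [deriv_absReg_sub hδ, deriv_absRegD_sub hδ]
    exact absRegDD_nonneg _

end absReg

/-! ### Kruzhkov fluxes of the approximation -/

/-- The flux `∫_0^a η'(s - k) F(s) ds` associated with the approximation `η` of `|·|`. -/
noncomputable def regFlux (δ : ℝ) (F : ℝ → ℝ) (a k : ℝ) : ℝ :=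
  ∫ s in (0 : ℝ)..a, absRegD δ (s - k) * F s

/-- The primitive `∫_0^a η''(s - k) F(s) ds`. -/
noncomputable def regPrim (δ : ℝ) (F : ℝ → ℝ) (a k : ℝ) : ℝ :=
  ∫ s in (0 : ℝ)..a, absRegDD δ (s - k) * F s

/-- The double primitive `∫_0^a ∫_0^b η''(s - w) H(s, w) dw ds`. -/
noncomputable def regDouble (δ : ℝ) (H : ℝ → ℝ → ℝ) (a b : ℝ) : ℝ :=
  ∫ s in (0 : ℝ)..a, ∫ w in (0 : ℝ)..b, absRegDD δ (s - w) * H s w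

section regFlux

variable {δ : ℝ}

theorem continuous_regFlux (hδ : 0 < δ) {F : ℝ → ℝ} (hF : Continuous F) :
    Continuous (Function.uncurry (regFlux δ F)) := by
  have := continuous_absRegD hδ
  exact intervalIntegral.continuous_parametric_intervalIntegral_of_continuous
    (f := fun (z : ℝ × ℝ) s => absRegD δ (s - z.2) * F s) (s := fun z : ℝ × ℝ => z.1)
    (by fun_prop) (by fun_prop)

theorem continuous_regPrim (hδ : 0 < δ) {F : ℝ → ℝ} (hF : Continuous F) :
    Continuous (Function.uncurry (regPrim δ F)) := by
  have := continuous_absRegDD hδ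
  exact intervalIntegral.continuous_parametric_intervalIntegral_of_continuous
    (f := fun (z : ℝ × ℝ) s => absRegDD δ (s - z.2) * F s) (s := fun z : ℝ × ℝ => z.1)
    (by fun_prop) (by fun_prop)

theorem continuous_regDouble_inner (hδ : 0 < δ) {H : ℝ → ℝ → ℝ} (hH : Continuous H.uncurry)
    (b : ℝ) : Continuous fun s => ∫ w in (0 : ℝ)..b, absRegDD δ (s - w) * H s w := by
  have := continuous_absRegDD hδ
  have hH' : Continuous fun z : ℝ × ℝ => H z.1 z.2 := hH
  exact intervalIntegral.continuous_parametric_intervalIntegral_of_continuous'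
    (f := fun s w => absRegDD δ (s - w) * H s w) (by simp only [Function.uncurry_def]; fun_prop) 0 b

theorem continuous_regDouble (hδ : 0 < δ) {H : ℝ → ℝ → ℝ} (hH : Continuous H.uncurry) :
    Continuous (Function.uncurry (regDouble δ H)) := by
  have := continuous_absRegDD hδ
  have hH' : Continuous fun z : ℝ × ℝ => H z.1 z.2 := hH
  have h1 : Continuous fun z : ℝ × ℝ => ∫ w in (0 : ℝ)..z.2, absRegDD δ (z.1 - w) * H z.1 w :=
    intervalIntegral.continuous_parametric_intervalIntegral_of_continuous
      (f := fun (z : ℝ × ℝ) w => absRegDD δ (z.1 - w) * H z.1 w) (s := fun z : ℝ × ℝ => z.2)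
      (by simp only [Function.uncurry_def]; fun_prop) (by fun_prop)
  exact intervalIntegral.continuous_parametric_intervalIntegral_of_continuous
    (f := fun (z : ℝ × ℝ) s => ∫ w in (0 : ℝ)..z.2, absRegDD δ (s - w) * H s w)
    (s := fun z : ℝ × ℝ => z.1)
    (h1.comp (f := fun y : (ℝ × ℝ) × ℝ => (y.2, y.1.2)) (by fun_prop)) (by fun_prop)

theorem regDouble_sub (hδ : 0 < δ) {H H' : ℝ → ℝ → ℝ} (hH : Continuous H.uncurry)
    (hH' : Continuous H'.uncurry) (a b : ℝ) :
    regDouble δ (fun s w => H s w - H' s w) a b = regDouble δ H a b - regDouble δ H' a b := by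
  have := continuous_absRegDD hδ
  have hc : Continuous fun z : ℝ × ℝ => H z.1 z.2 := hH
  have hc' : Continuous fun z : ℝ × ℝ => H' z.1 z.2 := hH'
  unfold regDouble
  rw [← intervalIntegral.integral_sub
    ((continuous_regDouble_inner hδ hH b).intervalIntegrable _ _)
    ((continuous_regDouble_inner hδ hH' b).intervalIntegrable _ _)]
  congr 1
  ext s
  rw [← intervalIntegral.integral_sub]
  · simp only [mul_sub]
  · exact Continuous.intervalIntegrable
      ((this.comp (by fun_prop)).mul (hc.comp (f := fun w => (s, w)) (by fun_prop))) _ _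
  · exact Continuous.intervalIntegrable
      ((this.comp (by fun_prop)).mul (hc'.comp (f := fun w => (s, w)) (by fun_prop))) _ _

theorem regDouble_const_mul (H : ℝ → ℝ → ℝ) (c a b : ℝ) :
    regDouble δ (fun s w => c * H s w) a b = c * regDouble δ H a b := by
  unfold regDouble
  rw [← intervalIntegral.integral_const_mul]
  congr 1
  ext s
  rw [← intervalIntegral.integral_const_mul]
  congr 1
  ext w
  ring

theorem regDouble_zero (a b : ℝ) : regDouble δ (fun _ _ => 0) a b = 0 := by simp [regDouble]

theorem regDouble_add (hδ : 0 < δ) {H H' : ℝ → ℝ → ℝ} (hH : Continuous H.uncurry)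
    (hH' : Continuous H'.uncurry) (a b : ℝ) :
    regDouble δ (fun s w => H s w + H' s w) a b = regDouble δ H a b + regDouble δ H' a b := by
  have h := regDouble_sub hδ hH (H' := fun s w => (-1) * H' s w)
    ((continuous_const (y := (-1 : ℝ))).mul hH') a b
  rw [regDouble_const_mul] at h
  simpa using h

theorem regDouble_sum (hδ : 0 < δ) {ι : Type*} (t : Finset ι) {H : ι → ℝ → ℝ → ℝ}
    (hH : ∀ k, Continuous (H k).uncurry) (a b : ℝ) :
    regDouble δ (fun s w => ∑ k ∈ t, H k s w) a b = ∑ k ∈ t, regDouble δ (H k) a b := by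
  classical
  induction t using Finset.induction_on with
  | empty => simp [regDouble_zero]
  | insert k t hk ih =>
    simp only [Finset.sum_insert hk]
    rw [regDouble_add hδ (hH k) (by
      simp only [Function.uncurry_def]
      exact continuous_finsetSum _ fun k _ => hH k), ih]

theorem regDouble_swap (hδ : 0 < δ) {H : ℝ → ℝ → ℝ} (hH : Continuous H.uncurry) (a b : ℝ) :
    ∫ w in (0 : ℝ)..b, ∫ s in (0 : ℝ)..a, absRegDD δ (s - w) * H s w = regDouble δ H a b := by
  have := continuous_absRegDD hδ
  have hH' : Continuous fun z : ℝ × ℝ => H z.1 z.2 := hH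
  refine (intervalIntegral_intervalIntegral_swap
    (F := fun s w => absRegDD δ (s - w) * H s w) ?_).symm
  have hc : Continuous (Function.uncurry fun s w => absRegDD δ (s - w) * H s w) := by
    simp only [Function.uncurry_def]; fun_prop
  exact (hc.continuousOn.integrableOn_compact
    (isCompact_uIcc.prod isCompact_uIcc)).mono_set
      (Set.prod_mono Set.uIoc_subset_uIcc Set.uIoc_subset_uIcc)

/-- Iterating the primitives of the two diffusion coefficients gives a double primitive. -/
theorem integral_regPrim_mul (hδ : 0 < δ) {F G : ℝ → ℝ} (hF : Continuous F) (hG : Continuous G)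
    (a b : ℝ) :
    ∫ w in (0 : ℝ)..b, regPrim δ F a w * G w = regDouble δ (fun s w => F s * G w) a b := by
  rw [← regDouble_swap hδ (by simp only [Function.uncurry_def]; fun_prop)]
  congr 1
  ext w
  unfold regPrim
  rw [← intervalIntegral.integral_mul_const]
  congr 1
  ext s
  ring

theorem integral_absRegDD_sub (hδ : 0 < δ) (s b : ℝ) :
    ∫ w in (0 : ℝ)..b, absRegDD δ (s - w) = absRegD δ s - absRegD δ (s - b) := by
  have h : ∀ w ∈ Set.uIcc 0 b,
      HasDerivAt (fun w => -absRegD δ (s - w)) (absRegDD δ (s - w)) w := fun w _ => by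
    have := ((hasDerivAt_absRegD hδ (s - w)).comp_const_sub s w).neg
    exact this.congr_deriv (neg_neg _)
  have hc := (continuous_absRegDD hδ).comp (continuous_sub_left s)
  rw [intervalIntegral.integral_eq_sub_of_hasDerivAt h (hc.intervalIntegrable _ _)]
  simp
  ring

/-- The dependence of the flux on the Kruzhkov constant is a double primitive. -/
theorem regFlux_eq (hδ : 0 < δ) {F : ℝ → ℝ} (hF : Continuous F) (a b : ℝ) :
    regFlux δ F a b = regFlux δ F a 0 - regDouble δ (fun s _ => F s) a b := by
  have hc := continuous_absRegD hδ
  unfold regFlux regDouble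
  rw [← intervalIntegral.integral_sub]
  · congr 1
    ext s
    rw [intervalIntegral.integral_mul_const, integral_absRegDD_sub hδ, sub_zero]
    ring
  · exact Continuous.intervalIntegrable (by fun_prop) _ _
  · exact Continuous.intervalIntegrable
      (continuous_regDouble_inner hδ (H := fun s _ => F s)
        (by simp only [Function.uncurry_def]; fun_prop) b) _ _

/-- Since η'' is even, the flux with the roles of `a` and `b` exchanged is a double primitive over
the same rectangle with the same weight η''(s - w). The two fluxes can therefore be combined under
one integral. -/
theorem regFlux_swap_eq (hδ : 0 < δ) {F : ℝ → ℝ} (hF : Continuous F) (a b : ℝ) :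
    regFlux δ F b a = regFlux δ F b 0 - regDouble δ (fun _ w => F w) a b := by
  rw [regFlux_eq hδ hF b a, ← regDouble_swap hδ (by simp only [Function.uncurry_def]; fun_prop)]
  unfold regDouble
  congr 2
  ext s
  congr 1
  ext w
  rw [← absRegDD_neg, neg_sub]

/-- Double primitives of functions vanishing on the diagonal are small. -/
theorem abs_regDouble_le (hδ : 0 < δ) {H : ℝ → ℝ → ℝ} {L M : ℝ} (hL : 0 ≤ L)
    (hH : ∀ s w, |s| ≤ M → |w| ≤ M → |H s w| ≤ L * |s - w|) {a b : ℝ} (ha : |a| ≤ M)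
    (hb : |b| ≤ M) : |regDouble δ H a b| ≤ L * Real.pi * M * δ := by
  have hM : 0 ≤ M := (abs_nonneg a).trans ha
  have hmem : ∀ {x y : ℝ}, |y| ≤ M → x ∈ Set.uIoc 0 y → |x| ≤ M := by
    intro x y hy hx
    rcases Set.mem_uIoc.1 hx with h | h
    · rw [abs_of_pos h.1]; exact h.2.trans ((le_abs_self y).trans hy)
    · rw [abs_of_nonpos h.2]
      linarith [neg_abs_le y]
  have hinner : ∀ s ∈ Set.uIoc 0 a,
      ‖∫ w in (0 : ℝ)..b, absRegDD δ (s - w) * H s w‖ ≤ L * Real.pi * δ := by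
    intro s hs
    have hcont : Continuous fun w : ℝ => L * (δ ^ 2 / ((s - w) ^ 2 + δ ^ 2)) := by
      refine continuous_const.mul (continuous_const.div (by fun_prop) fun w => ?_)
      exact (sq_add_sq_pos_of_pos hδ _).ne'
    have h1 := intervalIntegral.norm_integral_le_abs_of_norm_le (μ := volume) (a := 0) (b := b)
      (f := fun w => absRegDD δ (s - w) * H s w)
      (g := fun w => L * (δ ^ 2 / ((s - w) ^ 2 + δ ^ 2)))
      ((ae_restrict_iff' measurableSet_uIoc).2 (Eventually.of_forall fun w hw => by
        rw [Real.norm_eq_abs, abs_mul, abs_of_nonneg (absRegDD_nonneg _)]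
        calc absRegDD δ (s - w) * |H s w| ≤ absRegDD δ (s - w) * (L * |s - w|) :=
              mul_le_mul_of_nonneg_left (hH s w (hmem ha hs) (hmem hb hw)) (absRegDD_nonneg _)
          _ = L * (|s - w| * absRegDD δ (s - w)) := by ring
          _ ≤ _ := mul_le_mul_of_nonneg_left (abs_mul_absRegDD_le hδ _) hL))
      (hcont.intervalIntegrable _ _)
    -- The majorant has an arctangent as primitive, of total variation less than `L * δ * π`
    -- whatever the interval; this is the source of π in the constant.
    have h2 : ∀ w ∈ Set.uIcc 0 b, HasDerivAt (fun w => -(L * δ * Real.arctan ((s - w) / δ)))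
        (L * (δ ^ 2 / ((s - w) ^ 2 + δ ^ 2))) w := fun w _ => by
      have := (((((hasDerivAt_id w).const_sub s).div_const δ).arctan).const_mul (L * δ)).neg
      refine this.congr_deriv ?_
      simp only [id]
      have := sq_add_sq_pos_of_pos hδ (s - w)
      field_simp
      ring
    rw [intervalIntegral.integral_eq_sub_of_hasDerivAt h2 (hcont.intervalIntegrable _ _)] at h1
    refine h1.trans ?_
    have b1 := Real.arctan_lt_pi_div_two ((s - b) / δ)
    have b2 := Real.neg_pi_div_two_lt_arctan ((s - b) / δ)
    have b3 := Real.arctan_lt_pi_div_two ((s - 0) / δ)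
    have b4 := Real.neg_pi_div_two_lt_arctan ((s - 0) / δ)
    have hLδ : 0 ≤ L * δ := mul_nonneg hL hδ.le
    rw [show -(L * δ * Real.arctan ((s - b) / δ)) - -(L * δ * Real.arctan ((s - 0) / δ)) =
      (L * δ) * (Real.arctan ((s - 0) / δ) - Real.arctan ((s - b) / δ)) by ring, abs_mul,
      abs_of_nonneg hLδ, show L * Real.pi * δ = L * δ * Real.pi by ring]
    exact mul_le_mul_of_nonneg_left (abs_le.2 ⟨by linarith, by linarith⟩) hLδ
  have h := intervalIntegral.norm_integral_le_of_norm_le_const hinner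
  rw [sub_zero] at h
  calc |regDouble δ H a b| ≤ L * Real.pi * δ * |a| := h
    _ ≤ L * Real.pi * δ * M := by gcongr
    _ = _ := by ring

/-- Smooth functions vanishing on the diagonal are locally bounded by the distance to it. -/
theorem exists_diagonal_bound {H : ℝ → ℝ → ℝ} (hH : ContDiff ℝ 1 H.uncurry)
    (h0 : ∀ s, H s s = 0) (M : ℝ) :
    ∃ L, 0 ≤ L ∧ ∀ s w, |s| ≤ M → |w| ≤ M → |H s w| ≤ L * |s - w| := by
  have hK : IsCompact (Set.Icc (-M) M ×ˢ Set.Icc (-M) M) := isCompact_Icc.prod isCompact_Icc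
  obtain ⟨K, hK'⟩ := (hH.locallyLipschitz.locallyLipschitzOn
    (s := Set.Icc (-M) M ×ˢ Set.Icc (-M) M)).exists_lipschitzOnWith_of_compact hK
  refine ⟨K, K.2, fun s w hs hw => ?_⟩
  -- `H` vanishes at the diagonal point (s,s), at distance |s - w| from (s,w).
  have h := hK'.dist_le_mul (s, w) ⟨abs_le.1 hs, abs_le.1 hw⟩ (s, s) ⟨abs_le.1 hs, abs_le.1 hs⟩
  simp only [Function.uncurry, h0, Prod.dist_eq, dist_self, Real.dist_eq, sub_zero] at h
  rw [abs_sub_comm s w]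
  simpa using h

/-- The expression is minus the double primitive of F(s) - F(w), which vanishes on the diagonal. The
subtracted terms depend on one variable each, so they disappear when paired with spatial derivatives
of the kernel. -/
theorem exists_regFlux_sub_bound {F : ℝ → ℝ} (hF : ContDiff ℝ 1 F) (M : ℝ) :
    ∃ L, 0 ≤ L ∧ ∀ δ > 0, ∀ a b, |a| ≤ M → |b| ≤ M →
      |regFlux δ F a b - regFlux δ F b a - (regFlux δ F a 0 - regFlux δ F b 0)| ≤ L * δ := by
  obtain ⟨L, hL, hb⟩ := exists_diagonal_bound (H := fun s w => F s - F w)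
    (by simp only [Function.uncurry_def]; fun_prop) (fun s => sub_self _) M
  refine ⟨|L * Real.pi * M|, abs_nonneg _, fun δ hδ a b ha hb' => ?_⟩
  have hc := hF.continuous
  have h := abs_regDouble_le hδ hL hb ha hb'
  rw [regDouble_sub hδ (by simp only [Function.uncurry_def]; fun_prop)
    (by simp only [Function.uncurry_def]; fun_prop)] at h
  rw [regFlux_eq hδ hc a b, regFlux_swap_eq hδ hc a b, ← abs_neg]
  refine le_trans (le_of_eq ?_) (h.trans (mul_le_mul_of_nonneg_right (le_abs_self _) hδ.le))
  congr 1
  ring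

/-- For second-order terms the two fluxes add instead of cancelling, and the mixed dissipation
compensates: F(s) + F(w) - 2 ∑ σ_k(s) τ_k(w) vanishes on the diagonal exactly because F = ∑ σ_k τ_k.
-/
theorem exists_regFlux_add_bound {ι : Type*} [Fintype ι] {F : ℝ → ℝ} {σ τ : ι → ℝ → ℝ}
    (hF : ContDiff ℝ 1 F) (hσ : ∀ k, ContDiff ℝ 1 (σ k)) (hτ : ∀ k, ContDiff ℝ 1 (τ k))
    (hFστ : ∀ s, F s = ∑ k, σ k s * τ k s) (M : ℝ) :
    ∃ L, 0 ≤ L ∧ ∀ δ > 0, ∀ a b, |a| ≤ M → |b| ≤ M →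
      |regFlux δ F a b + regFlux δ F b a + 2 * ∑ k, regDouble δ (fun s w => σ k s * τ k w) a b
        - (regFlux δ F a 0 + regFlux δ F b 0)| ≤ L * δ := by
  obtain ⟨L, hL, hb⟩ := exists_diagonal_bound
    (H := fun s w => (F s + F w) - 2 * ∑ k, σ k s * τ k w)
    (by
      simp only [Function.uncurry_def]
      refine ContDiff.sub (by fun_prop) (contDiff_const.mul (ContDiff.sum fun k _ => ?_))
      exact ((hσ k).comp contDiff_fst).mul ((hτ k).comp contDiff_snd))
    (fun s => by rw [hFστ]; ring) M
  refine ⟨|L * Real.pi * M|, abs_nonneg _, fun δ hδ a b ha hb' => ?_⟩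
  have hc := hF.continuous
  have hστ : ∀ k, Continuous (Function.uncurry fun s w => σ k s * τ k w) := fun k => by
    simp only [Function.uncurry_def]
    exact ((hσ k).continuous.comp continuous_fst).mul ((hτ k).continuous.comp continuous_snd)
  have hsum : Continuous (Function.uncurry fun s w => ∑ k, σ k s * τ k w) := by
    simp only [Function.uncurry_def]
    exact continuous_finsetSum _ fun k _ => hστ k
  have h := abs_regDouble_le hδ hL hb ha hb'
  rw [regDouble_sub hδ (by simp only [Function.uncurry_def]; fun_prop)
    (H' := fun s w => 2 * ∑ k, σ k s * τ k w)
    ((continuous_const (y := (2 : ℝ))).mul hsum),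
    regDouble_add hδ (by simp only [Function.uncurry_def]; fun_prop)
    (by simp only [Function.uncurry_def]; fun_prop), regDouble_const_mul,
    regDouble_sum hδ _ hστ] at h
  rw [regFlux_eq hδ hc a b, regFlux_swap_eq hδ hc a b, ← abs_neg]
  refine le_trans (le_of_eq ?_) (h.trans (mul_le_mul_of_nonneg_right (le_abs_self _) hδ.le))
  congr 1
  ring

end regFlux

/-! ### Entropy solutions on a time slab -/

/-- The measure `dt dm` on `[α, β] × BohrCompact d`. -/
noncomputable def slab (d : ℕ) (α β : ℝ) : Measure (ℝ × BohrCompact d) :=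
  (volume.restrict (Set.Icc α β)).prod (haar d)

instance (d : ℕ) (α β : ℝ) : IsFiniteMeasure (slab d α β) := by
  unfold slab; infer_instance

variable {α β : ℝ}

theorem slab_eq_restrict (hα : 0 < α) :
    slab d α β = (spaceTime d).restrict (Set.Icc α β ×ˢ Set.univ) := by
  unfold slab spaceTime
  conv_lhs => rw [← Measure.restrict_univ (μ := haar d)]
  rw [← Measure.prod_restrict, Measure.restrict_restrict measurableSet_Icc,
    Set.inter_eq_left.2 (show Set.Icc α β ⊆ Set.Ioi 0 from fun t ht => lt_of_lt_of_le hα ht.1)]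

theorem integral_slab_eq (hα : 0 < α) {F : ℝ × BohrCompact d → ℝ}
    (hF : ∀ p : ℝ × BohrCompact d, p.1 ∉ Set.Icc α β → F p = 0) :
    ∫ p, F p ∂(slab d α β) = ∫ p, F p ∂(spaceTime d) := by
  rw [slab_eq_restrict hα]
  exact setIntegral_eq_integral_of_forall_compl_eq_zero fun p hp =>
    hF p fun h => hp ⟨h, trivial⟩

theorem ae_slab_fst_mem : ∀ᵐ p ∂(slab d α β), p.1 ∈ Set.Icc α β :=
  Measure.quasiMeasurePreserving_fst.ae (ae_restrict_mem measurableSet_Icc)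

/-- `u` is measurable and bounded by `M` almost everywhere on the slab. -/
structure IsBoundedOn (α β M : ℝ) (u : ℝ × BohrCompact d → ℝ) : Prop where
  meas : AEStronglyMeasurable u (slab d α β)
  bound : ∀ᵐ p ∂(slab d α β), |u p| ≤ M

/-- The weak formulations of the chain rule and of the entropy inequality on a time slab, tested
with products of a function of time and a trigonometric polynomial. -/
structure IsSlabSolution (P : Coefficients d) (α β : ℝ) (u : ℝ × BohrCompact d → ℝ)
    (g : Fin d → ℝ × BohrCompact d → ℝ) : Prop where
  memLp : ∀ k, MemLp (g k) 2 (slab d α β)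
  chain : ∀ ψ : ℝ → ℝ, Continuous ψ → ∀ k, ∀ (a : ℝ → ℝ) (b : BohrCompact d → ℝ),
    ContDiff ℝ ∞ a → IsTrig b → (∀ t, t ∉ Set.Icc α β → a t = 0) →
    ∫ p, ∑ i, P.β ψ i k (u p) * (a p.1 * dirDeriv i b p.2) ∂(slab d α β) =
      -∫ p, ψ (u p) * g k p * (a p.1 * b p.2) ∂(slab d α β)
  entropy : ∀ δ > 0, ∀ (c : ℝ) (a : ℝ → ℝ) (b : BohrCompact d → ℝ),
    ContDiff ℝ ∞ a → IsTrig b → (∀ t, t ∉ Set.Icc α β → a t = 0) → (∀ t, 0 ≤ a t) →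
    (∀ w, 0 ≤ b w) →
    ∫ p, absRegDD δ (u p - c) * (∑ k, g k p ^ 2) * (a p.1 * b p.2) ∂(slab d α β) ≤
      ∫ p, (absReg δ (u p - c) * (deriv a p.1 * b p.2)
        + ∑ i, regFlux δ (deriv (P.f i)) (u p) c * (a p.1 * dirDeriv i b p.2)
        + ∑ i, ∑ j, regFlux δ (deriv (P.A i j)) (u p) c *
            (a p.1 * dirDeriv i (dirDeriv j b) p.2)) ∂(slab d α β)

theorem deriv_eq_zero_of_forall_notMem {a : ℝ → ℝ} (ha : ∀ t, t ∉ Set.Icc α β → a t = 0) {t : ℝ}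
    (ht : t ∉ Set.Icc α β) : deriv a t = 0 := by
  have : a =ᶠ[𝓝 t] fun _ => 0 := by
    filter_upwards [isClosed_Icc.isOpen_compl.mem_nhds ht] with s hs using ha s hs
  rw [this.deriv_eq, deriv_const]

theorem exists_isSlabSolution {P : Coefficients d} {u₀ : BohrCompact d → ℝ}
    {u : ℝ × BohrCompact d → ℝ} (h : IsEntropySolution P u₀ u) :
    ∃ g, ∀ α β, 0 < α → IsSlabSolution P α β u g := by
  obtain ⟨-, -, ⟨g, hg1, hg2, hg3⟩, -⟩ := h
  refine ⟨g, fun α β hα => ⟨fun k => ?_, ?_, ?_⟩⟩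
  · rw [slab_eq_restrict hα]
    exact (hg1 k).1.restrict _
  · intro ψ hψ k a b ha hb hs
    have h := (hg2 ψ hψ k).2 _ (isTest_mul hα ha hb hs)
    simp only [dx_mul] at h
    rw [integral_slab_eq hα, integral_slab_eq hα, h]
    · intro p hp
      simp [hs _ hp]
    · intro p hp
      simp [hs _ hp]
  · intro δ hδ c a b ha hb hs ha0 hb0
    -- Entropies must be convex and C², so the Kruzhkov entropy |r - c| enters through its
    -- regularization.
    have h := hg3 _ (convexOn_absReg_sub hδ c) (contDiff_absReg_sub hδ c) _
      (isTest_mul hα ha hb hs) fun p => mul_nonneg (ha0 _) (hb0 _)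
    have hdx : ∀ i j : Fin d, ∀ p, dx i (dx j fun p : ℝ × BohrCompact d => a p.1 * b p.2) p =
        a p.1 * dirDeriv i (dirDeriv j b) p.2 := fun i j p => by
      rw [show (dx j fun p : ℝ × BohrCompact d => a p.1 * b p.2) =
        fun p => a p.1 * dirDeriv j b p.2 from funext (dx_mul j a b), dx_mul]
    simp only [dx_mul, dt_mul, hdx, deriv_absReg_sub hδ, deriv_absRegD_sub hδ, Coefficients.q,
      Coefficients.r, prim] at h
    rw [integral_slab_eq hα, integral_slab_eq hα]
    · exact h
    · intro p hp
      simp [hs _ hp, deriv_eq_zero_of_forall_notMem hs hp]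
    · intro p hp
      simp [hs _ hp]

/-! ### Doubling of variables -/

/-- The kernel `κ(t, s) b(x - y)` on pairs of points `(t, x)`, `(s, y)`. -/
def kernel (κ : ℝ → ℝ → ℝ) (b : BohrCompact d → ℝ)
    (z : (ℝ × BohrCompact d) × (ℝ × BohrCompact d)) : ℝ :=
  κ z.1.1 z.2.1 * b (z.1.2 - z.2.2)

/-- The measure on pairs of points of a slab. -/
noncomputable def slab₂ (d : ℕ) (α β : ℝ) :
    Measure ((ℝ × BohrCompact d) × (ℝ × BohrCompact d)) :=
  (slab d α β).prod (slab d α β)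

instance (d : ℕ) (α β : ℝ) : IsFiniteMeasure (slab₂ d α β) := by
  unfold slab₂; infer_instance

theorem measurable_kernel {κ : ℝ → ℝ → ℝ} {b : BohrCompact d → ℝ} (hκ : Continuous κ.uncurry)
    (hb : IsTrig b) : Measurable (kernel κ b) := by
  have h1 : Measurable fun z : (ℝ × BohrCompact d) × (ℝ × BohrCompact d) => (z.1.1, z.2.1) := by
    fun_prop
  have h2 : Measurable fun z : (ℝ × BohrCompact d) × (ℝ × BohrCompact d) => (z.1.2, z.2.2) := by
    fun_prop
  exact (hκ.measurable.comp h1).mul (hb.measurable_sub.comp h2)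

theorem ae_slab₂_of_fst {p : ℝ × BohrCompact d → Prop} (h : ∀ᵐ x ∂(slab d α β), p x) :
    ∀ᵐ z ∂(slab₂ d α β), p z.1 := Measure.quasiMeasurePreserving_fst.ae h

theorem ae_slab₂_of_snd {p : ℝ × BohrCompact d → Prop} (h : ∀ᵐ x ∂(slab d α β), p x) :
    ∀ᵐ z ∂(slab₂ d α β), p z.2 := Measure.quasiMeasurePreserving_snd.ae h

theorem exists_kernel_bound {κ : ℝ → ℝ → ℝ} {b : BohrCompact d → ℝ} (hκ : Continuous κ.uncurry)
    (hb : IsTrig b) : ∃ C, 0 ≤ C ∧ ∀ᵐ z ∂(slab₂ d α β), |kernel κ b z| ≤ C := by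
  obtain ⟨B, hB⟩ := hb.bounded
  obtain ⟨K, hK⟩ := ((isCompact_Icc (a := α) (b := β)).prod
    (isCompact_Icc (a := α) (b := β))).exists_bound_of_continuousOn hκ.continuousOn
  refine ⟨|K| * |B|, by positivity, ?_⟩
  filter_upwards [ae_slab₂_of_fst ae_slab_fst_mem, ae_slab₂_of_snd ae_slab_fst_mem] with z h1 h2
  have h3 := hK (z.1.1, z.2.1) ⟨h1, h2⟩
  rw [kernel, abs_mul]
  exact mul_le_mul (h3.trans (le_abs_self _)) ((hB _).trans (le_abs_self _)) (abs_nonneg _)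
    (abs_nonneg _)

section

variable {M : ℝ} {u v : ℝ × BohrCompact d → ℝ} {κ : ℝ → ℝ → ℝ} {b : BohrCompact d → ℝ}
  {c : ℝ → ℝ → ℝ}

/-- The weight stands for g_k², h_k² or g_k h_k, for which only integrability is available; the
other two factors are essentially bounded on the slab. -/
theorem integrable_weight_kernel (hu : IsBoundedOn α β M u) (hv : IsBoundedOn α β M v)
    (hc : Continuous c.uncurry) {w : (ℝ × BohrCompact d) × (ℝ × BohrCompact d) → ℝ}
    (hw : Integrable w (slab₂ d α β)) (hκ : Continuous κ.uncurry) (hb : IsTrig b) :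
    Integrable (fun z => c (u z.1) (v z.2) * w z * kernel κ b z) (slab₂ d α β) := by
  obtain ⟨C, -, hC⟩ := exists_kernel_bound (α := α) (β := β) hκ hb
  obtain ⟨K, hK⟩ := ((isCompact_Icc (a := -M) (b := M)).prod
    (isCompact_Icc (a := -M) (b := M))).exists_bound_of_continuousOn hc.continuousOn
  refine (hw.bdd_mul (c := K) (f := fun z => c (u z.1) (v z.2)) ?_ ?_).mul_bdd (c := C)
    (measurable_kernel hκ hb).aestronglyMeasurable hC
  · exact hc.comp_aestronglyMeasurable (hu.meas.comp_fst.prodMk hv.meas.comp_snd)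
  · filter_upwards [ae_slab₂_of_fst hu.bound, ae_slab₂_of_snd hv.bound] with z h1 h2
    exact hK (u z.1, v z.2) ⟨abs_le.1 h1, abs_le.1 h2⟩

theorem integrable_kernel (hu : IsBoundedOn α β M u) (hv : IsBoundedOn α β M v)
    (hc : Continuous c.uncurry) (hκ : Continuous κ.uncurry) (hb : IsTrig b) :
    Integrable (fun z => c (u z.1) (v z.2) * kernel κ b z) (slab₂ d α β) := by
  simpa using integrable_weight_kernel hu hv hc (integrable_const (1 : ℝ)) hκ hb

/-- The integral of `c(u(t,x), v(s,y)) κ(t,s) b(x-y)`. -/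
noncomputable def pairing (α β : ℝ) (u v : ℝ × BohrCompact d → ℝ) (c : ℝ → ℝ → ℝ)
    (κ : ℝ → ℝ → ℝ) (b : BohrCompact d → ℝ) : ℝ :=
  ∫ z, c (u z.1) (v z.2) * kernel κ b z ∂(slab₂ d α β)

theorem pairing_add (hu : IsBoundedOn α β M u) (hv : IsBoundedOn α β M v) {c' : ℝ → ℝ → ℝ}
    (hc : Continuous c.uncurry) (hc' : Continuous c'.uncurry) (hκ : Continuous κ.uncurry)
    (hb : IsTrig b) :
    pairing α β u v (fun r s => c r s + c' r s) κ b =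
      pairing α β u v c κ b + pairing α β u v c' κ b := by
  unfold pairing
  rw [← integral_add (integrable_kernel hu hv hc hκ hb) (integrable_kernel hu hv hc' hκ hb)]
  simp only [add_mul]

theorem pairing_const_mul (x : ℝ) :
    pairing α β u v (fun r s => x * c r s) κ b = x * pairing α β u v c κ b := by
  unfold pairing
  rw [← integral_const_mul]
  simp only [mul_assoc]

theorem pairing_sub (hu : IsBoundedOn α β M u) (hv : IsBoundedOn α β M v) {c' : ℝ → ℝ → ℝ}
    (hc : Continuous c.uncurry) (hc' : Continuous c'.uncurry) (hκ : Continuous κ.uncurry)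
    (hb : IsTrig b) :
    pairing α β u v (fun r s => c r s - c' r s) κ b =
      pairing α β u v c κ b - pairing α β u v c' κ b := by
  unfold pairing
  rw [← integral_sub (integrable_kernel hu hv hc hκ hb) (integrable_kernel hu hv hc' hκ hb)]
  simp only [sub_mul]

theorem pairing_sum (hu : IsBoundedOn α β M u) (hv : IsBoundedOn α β M v) {ι : Type*}
    (t : Finset ι) {c : ι → ℝ → ℝ → ℝ} (hc : ∀ k, Continuous (c k).uncurry)
    (hκ : Continuous κ.uncurry) (hb : IsTrig b) :
    pairing α β u v (fun r s => ∑ k ∈ t, c k r s) κ b = ∑ k ∈ t, pairing α β u v (c k) κ b := by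
  unfold pairing
  rw [← integral_finsetSum _ fun k _ => integrable_kernel hu hv (hc k) hκ hb]
  simp only [Finset.sum_mul]

/-- The constant is chosen before `c`, so a bound of order δ on a δ-dependent integrand passes to
its pairing. -/
theorem exists_pairing_bound (hu : IsBoundedOn α β M u) (hv : IsBoundedOn α β M v)
    (hκ : Continuous κ.uncurry) (hb : IsTrig b) :
    ∃ C, 0 ≤ C ∧ ∀ (c : ℝ → ℝ → ℝ) (ε : ℝ), (∀ r s, |r| ≤ M → |s| ≤ M → |c r s| ≤ ε) →
      |pairing α β u v c κ b| ≤ C * ε := by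
  obtain ⟨C, hC0, hC⟩ := exists_kernel_bound (α := α) (β := β) hκ hb
  refine ⟨C * (slab₂ d α β).real Set.univ, by positivity, fun c ε hc => ?_⟩
  have : ∀ᵐ z ∂(slab₂ d α β), ‖c (u z.1) (v z.2) * kernel κ b z‖ ≤ ε * C := by
    filter_upwards [ae_slab₂_of_fst hu.bound, ae_slab₂_of_snd hv.bound, hC] with z h1 h2 h3
    rw [norm_mul]
    exact mul_le_mul (hc _ _ h1 h2) h3 (abs_nonneg _) ((abs_nonneg _).trans (hc _ _ h1 h2))
  refine (norm_integral_le_of_norm_le_const this).trans (le_of_eq ?_)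
  ring

/-- Functions of one of the two solutions do not contribute to the spatial terms. -/
theorem pairing_fst_dirDeriv (hu : IsBoundedOn α β M u) (hv : IsBoundedOn α β M v) {F : ℝ → ℝ}
    (hF : Continuous F) (hκ : Continuous κ.uncurry) (hb : IsTrig b) (i : Fin d) :
    pairing α β u v (fun r _ => F r) κ (dirDeriv i b) = 0 := by
  unfold pairing slab₂
  rw [integral_prod _ (integrable_kernel hu hv (c := fun r _ => F r)
    (hF.comp continuous_fst) hκ (hb.dirDeriv i))]
  refine integral_eq_zero_of_ae (Eventually.of_forall fun p => ?_)
  simp only [kernel, Pi.zero_apply]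
  rw [integral_const_mul, slab, integral_prod_mul (fun s => κ p.1 s)
    fun y => dirDeriv i b (p.2 - y)]
  have h := integral_dirDeriv (hb.comp_const_sub p.2) i
  simp only [dirDeriv_comp_const_sub, integral_neg, neg_eq_zero] at h
  rw [h, mul_zero, mul_zero]

theorem pairing_snd_dirDeriv (hu : IsBoundedOn α β M u) (hv : IsBoundedOn α β M v) {F : ℝ → ℝ}
    (hF : Continuous F) (hκ : Continuous κ.uncurry) (hb : IsTrig b) (i : Fin d) :
    pairing α β u v (fun _ r => F r) κ (dirDeriv i b) = 0 := by
  unfold pairing slab₂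
  rw [integral_prod_symm _ (integrable_kernel hu hv (c := fun _ r => F r)
    (hF.comp continuous_snd) hκ (hb.dirDeriv i))]
  refine integral_eq_zero_of_ae (Eventually.of_forall fun p => ?_)
  simp only [kernel, Pi.zero_apply]
  rw [integral_const_mul, slab, integral_prod_mul (fun s => κ s p.1)
    fun y => dirDeriv i b (y - p.2)]
  have h := integral_dirDeriv (hb.comp_sub_const p.2) i
  simp only [dirDeriv_comp_sub_const] at h
  rw [h, mul_zero, mul_zero]

theorem pairing_swap (c : ℝ → ℝ → ℝ) (κ : ℝ → ℝ → ℝ) (b : BohrCompact d → ℝ) :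
    pairing α β v u (fun r s => c s r) (fun t s => κ s t) (fun w => b (-w)) =
      pairing α β u v c κ b := by
  unfold pairing slab₂
  rw [← integral_prod_swap]
  simp only [kernel, Prod.fst_swap, Prod.snd_swap, neg_sub]

end

/-- A time kernel on a slab, smooth and compactly supported in each variable, with its partial
derivatives. -/
structure IsTimeKernel (α β : ℝ) (τ τ₁ : ℝ → ℝ → ℝ) : Prop where
  cont : Continuous τ.uncurry
  cont₁ : Continuous τ₁.uncurry
  nonneg : ∀ t s, 0 ≤ τ t s
  smooth : ∀ s, ContDiff ℝ ∞ fun t => τ t s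
  deriv_eq : ∀ t s, deriv (fun t => τ t s) t = τ₁ t s
  supp : ∀ t s, t ∉ Set.Icc α β → τ t s = 0

/-! ### Kruzhkov's inequality for two solutions on a slab -/

section

variable {M : ℝ} {u v : ℝ × BohrCompact d → ℝ} {g h : Fin d → ℝ × BohrCompact d → ℝ}
  {τ τ₁ τ₂ : ℝ → ℝ → ℝ} {ρ : BohrCompact d → ℝ} {P : Coefficients d} {δ : ℝ}

theorem Coefficients.contDiff_deriv_f (P : Coefficients d) (i : Fin d) :
    ContDiff ℝ 1 (deriv (P.f i)) :=
  ((contDiff_infty_iff_deriv.1 (P.smooth_f i)).2).of_le (by simp)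

theorem Coefficients.contDiff_deriv_A (P : Coefficients d) (i j : Fin d) :
    ContDiff ℝ 1 (deriv (P.A i j)) :=
  ((contDiff_infty_iff_deriv.1 (P.smooth_A i j)).2).of_le (by simp)

theorem Coefficients.contDiff_σ (P : Coefficients d) (i j : Fin d) :
    ContDiff ℝ 1 (P.σ i j) := (P.smooth_σ i j).of_le (by simp)

theorem continuous_sub_comp {f : ℝ → ℝ} (hf : Continuous f) :
    Continuous (Function.uncurry fun r s : ℝ => f (r - s)) := by
  simp only [Function.uncurry_def]; fun_prop

/-- The entropy inequality of `u` with Kruzhkov constants `v(s,y)`, integrated in `(s,y)`. -/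
theorem IsSlabSolution.entropy_double (hs : IsSlabSolution P α β u g)
    (hu : IsBoundedOn α β M u) (hv : IsBoundedOn α β M v) (hδ : 0 < δ)
    (hτ : IsTimeKernel α β τ τ₁) (hρ : IsTrig ρ) (hρ0 : ∀ w, 0 ≤ ρ w) :
    ∫ z, absRegDD δ (u z.1 - v z.2) * (∑ k, g k z.1 ^ 2) * kernel τ ρ z ∂(slab₂ d α β) ≤
      pairing α β u v (fun r s => absReg δ (r - s)) τ₁ ρ
      + ∑ i, pairing α β u v (regFlux δ (deriv (P.f i))) τ (dirDeriv i ρ)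
      + ∑ i, ∑ j, pairing α β u v (regFlux δ (deriv (P.A i j))) τ
          (dirDeriv i (dirDeriv j ρ)) := by
  have i0 : Integrable (fun z : (ℝ × BohrCompact d) × (ℝ × BohrCompact d) =>
      absRegDD δ (u z.1 - v z.2) * (∑ k, g k z.1 ^ 2) * kernel τ ρ z) (slab₂ d α β) :=
    integrable_weight_kernel hu hv (continuous_sub_comp (continuous_absRegDD hδ))
      ((integrable_finsetSum _ fun k _ => (hs.memLp k).integrable_sq).comp_fst _) hτ.cont hρ
  have i1 := integrable_kernel hu hv (continuous_sub_comp (continuous_absReg (δ := δ)))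
    hτ.cont₁ hρ
  have i2 : ∀ i, _ := fun i => integrable_kernel hu hv
    (continuous_regFlux hδ (P.contDiff_deriv_f i).continuous) hτ.cont (hρ.dirDeriv i)
  have i3 : ∀ i j, _ := fun i j => integrable_kernel hu hv
    (continuous_regFlux hδ (P.contDiff_deriv_A i j).continuous) hτ.cont ((hρ.dirDeriv j).dirDeriv i)
  have i23 := integrable_finsetSum Finset.univ fun i _ => i2 i
  have i33 := integrable_finsetSum Finset.univ fun i _ =>
    integrable_finsetSum Finset.univ fun j _ => i3 i j
  have i12 : Integrable (fun z : (ℝ × BohrCompact d) × (ℝ × BohrCompact d) =>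
      absReg δ (u z.1 - v z.2) * kernel τ₁ ρ z
        + ∑ i, regFlux δ (deriv (P.f i)) (u z.1) (v z.2) * kernel τ (dirDeriv i ρ) z)
      (slab₂ d α β) := i1.add i23
  have i4 : Integrable (fun z : (ℝ × BohrCompact d) × (ℝ × BohrCompact d) =>
      absReg δ (u z.1 - v z.2) * kernel τ₁ ρ z
        + ∑ i, regFlux δ (deriv (P.f i)) (u z.1) (v z.2) * kernel τ (dirDeriv i ρ) z
        + ∑ i, ∑ j, regFlux δ (deriv (P.A i j)) (u z.1) (v z.2) *
            kernel τ (dirDeriv i (dirDeriv j ρ)) z) (slab₂ d α β) := i12.add i33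
  have e : pairing α β u v (fun r s => absReg δ (r - s)) τ₁ ρ
      + ∑ i, pairing α β u v (regFlux δ (deriv (P.f i))) τ (dirDeriv i ρ)
      + ∑ i, ∑ j, pairing α β u v (regFlux δ (deriv (P.A i j))) τ (dirDeriv i (dirDeriv j ρ)) =
      ∫ z, (absReg δ (u z.1 - v z.2) * kernel τ₁ ρ z
        + ∑ i, regFlux δ (deriv (P.f i)) (u z.1) (v z.2) * kernel τ (dirDeriv i ρ) z
        + ∑ i, ∑ j, regFlux δ (deriv (P.A i j)) (u z.1) (v z.2) *
            kernel τ (dirDeriv i (dirDeriv j ρ)) z) ∂(slab₂ d α β) := by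
    rw [integral_add i12 i33, integral_add i1 i23, integral_finsetSum _ fun i _ => i2 i,
      integral_finsetSum _ fun i _ => integrable_finsetSum _ fun j _ => i3 i j]
    simp only [fun i => integral_finsetSum Finset.univ fun j _ => i3 i j]
    rfl
  rw [e]
  unfold slab₂ at i0 i4 ⊢
  -- The point (s,y) becomes the outer variable; for each of its values the inner integrals are the
  -- two sides of one entropy inequality with constant `v q`.
  rw [integral_prod_symm _ i0, integral_prod_symm _ i4]
  refine integral_mono i0.integral_prod_right i4.integral_prod_right fun q => ?_
  have key := hs.entropy δ hδ (v q) (fun t => τ t q.1) (fun w => ρ (w - q.2)) (hτ.smooth q.1)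
    (hρ.comp_sub_const q.2) (fun t ht => hτ.supp t q.1 ht) (fun t => hτ.nonneg t q.1)
    fun w => hρ0 _
  have e2 : ∀ j, dirDeriv j (fun w => ρ (w - q.2)) = fun w => dirDeriv j ρ (w - q.2) := fun j =>
    funext fun w => dirDeriv_comp_sub_const j ρ q.2 w
  simp only [e2, dirDeriv_comp_sub_const, hτ.deriv_eq] at key
  exact key

theorem dirDeriv_comp_neg (i : Fin d) (b : BohrCompact d → ℝ) (w : BohrCompact d) :
    dirDeriv i (fun w => b (-w)) w = -dirDeriv i b (-w) := by
  simpa using dirDeriv_comp_const_sub i b 0 w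

theorem dirDeriv_dirDeriv_comp_neg (i j : Fin d) (b : BohrCompact d → ℝ) :
    dirDeriv i (dirDeriv j fun w => b (-w)) = fun w => dirDeriv i (dirDeriv j b) (-w) := by
  rw [show (dirDeriv j fun w => b (-w)) = fun w => -dirDeriv j b (-w) from
    funext (dirDeriv_comp_neg j b)]
  funext w
  rw [dirDeriv_neg i fun w => dirDeriv j b (-w), dirDeriv_comp_neg, neg_neg]

theorem pairing_neg (c : ℝ → ℝ → ℝ) (κ : ℝ → ℝ → ℝ) (b : BohrCompact d → ℝ) :
    pairing α β u v c κ (fun w => -b w) = -pairing α β u v c κ b := by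
  unfold pairing
  rw [← integral_neg]
  simp only [kernel, mul_neg]

/-- The entropy inequality of `v` with Kruzhkov constants `u(t,x)`, integrated in `(t,x)`. -/
theorem IsSlabSolution.entropy_double_snd (hs : IsSlabSolution P α β v h)
    (hu : IsBoundedOn α β M u) (hv : IsBoundedOn α β M v) (hδ : 0 < δ)
    (hτ : IsTimeKernel α β (fun s t => τ t s) (fun s t => τ₂ t s)) (hρ : IsTrig ρ)
    (hρ0 : ∀ w, 0 ≤ ρ w) :
    ∫ z, absRegDD δ (u z.1 - v z.2) * (∑ k, h k z.2 ^ 2) * kernel τ ρ z ∂(slab₂ d α β) ≤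
      pairing α β u v (fun r s => absReg δ (r - s)) τ₂ ρ
      - ∑ i, pairing α β u v (fun r s => regFlux δ (deriv (P.f i)) s r) τ (dirDeriv i ρ)
      + ∑ i, ∑ j, pairing α β u v (fun r s => regFlux δ (deriv (P.A i j)) s r) τ
          (dirDeriv i (dirDeriv j ρ)) := by
  -- The previous inequality is used with the solutions exchanged and ρ reflected. Reflection
  -- changes the sign of first derivatives only, which explains the minus sign of the convective
  -- term.
  have key := hs.entropy_double hv hu hδ hτ hρ.comp_neg fun w => hρ0 (-w)
  have e1 : ∫ z, absRegDD δ (v z.1 - u z.2) * (∑ k, h k z.1 ^ 2) *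
      kernel (fun s t => τ t s) (fun w => ρ (-w)) z ∂(slab₂ d α β) =
      ∫ z, absRegDD δ (u z.1 - v z.2) * (∑ k, h k z.2 ^ 2) * kernel τ ρ z ∂(slab₂ d α β) := by
    unfold slab₂
    rw [← integral_prod_swap]
    refine integral_congr_ae (Eventually.of_forall fun z => ?_)
    simp only [kernel, Prod.fst_swap, Prod.snd_swap, neg_sub]
    rw [← absRegDD_neg, neg_sub]
  have e2 : pairing α β v u (fun r s => absReg δ (r - s)) (fun s t => τ₂ t s)
      (fun w => ρ (-w)) = pairing α β u v (fun r s => absReg δ (r - s)) τ₂ ρ := by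
    rw [← pairing_swap]
    simp only [neg_neg]
    congr 1
    funext r s
    rw [← absReg_neg, neg_sub]
  rw [e1, e2] at key
  refine key.trans (le_of_eq ?_)
  simp only [show ∀ i, dirDeriv i (fun w => ρ (-w)) = fun w => -dirDeriv i ρ (-w) from
    fun i => funext (dirDeriv_comp_neg i ρ), pairing_neg, Finset.sum_neg_distrib]
  have e3 : ∀ i, pairing α β v u (regFlux δ (deriv (P.f i))) (fun s t => τ t s)
      (fun w => dirDeriv i ρ (-w)) =
      pairing α β u v (fun r s => regFlux δ (deriv (P.f i)) s r) τ (dirDeriv i ρ) := fun i =>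
    pairing_swap (fun r s => regFlux δ (deriv (P.f i)) s r) τ (dirDeriv i ρ)
  have e4 : ∀ i j, pairing α β v u (regFlux δ (deriv (P.A i j))) (fun s t => τ t s)
      (dirDeriv i fun w => -dirDeriv j ρ (-w)) =
      pairing α β u v (fun r s => regFlux δ (deriv (P.A i j)) s r) τ
        (dirDeriv i (dirDeriv j ρ)) := fun i j => by
    rw [show (fun w => -dirDeriv j ρ (-w)) = dirDeriv j fun w => ρ (-w) from
      (funext (dirDeriv_comp_neg j ρ)).symm, dirDeriv_dirDeriv_comp_neg]
    exact pairing_swap (fun r s => regFlux δ (deriv (P.A i j)) s r) τ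
      (dirDeriv i (dirDeriv j ρ))
  simp only [e3, e4, ← sub_eq_add_neg]

/-- The mixed dissipation, rewritten by applying the chain rule in both variables. -/
theorem IsSlabSolution.cross_double (hs : IsSlabSolution P α β u g)
    (hs' : IsSlabSolution P α β v h)
    (hu : IsBoundedOn α β M u) (hv : IsBoundedOn α β M v) (hδ : 0 < δ)
    (hτ : IsTimeKernel α β τ τ₁) (hτ' : IsTimeKernel α β (fun s t => τ t s) (fun s t => τ₂ t s))
    (hρ : IsTrig ρ) (k : Fin d) :
    ∫ z, absRegDD δ (u z.1 - v z.2) * (g k z.1 * h k z.2) * kernel τ ρ z ∂(slab₂ d α β) =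
      -∑ i, ∑ j, pairing α β u v (regDouble δ fun s w => P.σ i k s * P.σ j k w) τ
          (dirDeriv j (dirDeriv i ρ)) := by
  have hσ : ∀ i, Continuous (P.σ i k) := fun i => (P.contDiff_σ i k).continuous
  have hg1 : Integrable (g k) (slab d α β) := (hs.memLp k).integrable (by norm_num)
  have hh1 : Integrable (h k) (slab d α β) := (hs'.memLp k).integrable (by norm_num)
  have i0 : Integrable (fun z : (ℝ × BohrCompact d) × (ℝ × BohrCompact d) =>
      absRegDD δ (u z.1 - v z.2) * (g k z.1 * h k z.2) * kernel τ ρ z) (slab₂ d α β) :=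
    integrable_weight_kernel hu hv (continuous_sub_comp (continuous_absRegDD hδ))
      (hg1.mul_prod hh1) hτ.cont hρ
  have i1 : ∀ i, Integrable (fun z : (ℝ × BohrCompact d) × (ℝ × BohrCompact d) =>
      regPrim δ (P.σ i k) (u z.1) (v z.2) * h k z.2 * kernel τ (dirDeriv i ρ) z)
      (slab₂ d α β) := fun i =>
    integrable_weight_kernel hu hv (continuous_regPrim hδ (hσ i)) (hh1.comp_snd _)
      hτ.cont (hρ.dirDeriv i)
  have i2 : ∀ i j, Integrable (fun z : (ℝ × BohrCompact d) × (ℝ × BohrCompact d) =>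
      regDouble δ (fun s w => P.σ i k s * P.σ j k w) (u z.1) (v z.2) *
        kernel τ (dirDeriv j (dirDeriv i ρ)) z) (slab₂ d α β) := fun i j =>
    integrable_kernel hu hv (continuous_regDouble hδ (by
      have := hσ i
      have := hσ j
      simp only [Function.uncurry_def]; fun_prop)) hτ.cont ((hρ.dirDeriv i).dirDeriv j)
  have step1 : ∫ z, absRegDD δ (u z.1 - v z.2) * (g k z.1 * h k z.2) * kernel τ ρ z
      ∂(slab₂ d α β) = -∑ i, ∫ z, regPrim δ (P.σ i k) (u z.1) (v z.2) * h k z.2 *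
        kernel τ (dirDeriv i ρ) z ∂(slab₂ d α β) := by
    rw [← integral_finsetSum _ fun i _ => i1 i, ← integral_neg]
    have i1' := (integrable_finsetSum Finset.univ fun i _ => i1 i).neg
    unfold slab₂ at i0 i1' ⊢
    rw [integral_prod_symm _ i0]
    erw [integral_prod_symm _ i1']
    congr 1
    funext q
    -- First chain rule, in x with (s,y) frozen: ψ is η'' centred at `v q`, and integrating it
    -- against σ_ik gives `regPrim`.
    have key := hs.chain (fun s => absRegDD δ (s - v q))
      ((continuous_absRegDD hδ).comp (continuous_id.sub continuous_const)) k (fun t => τ t q.1)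
      (fun w => ρ (w - q.2)) (hτ.smooth q.1) (hρ.comp_sub_const q.2) fun t ht => hτ.supp t q.1 ht
    simp only [dirDeriv_comp_sub_const] at key
    calc ∫ p, absRegDD δ (u p - v q) * (g k p * h k q) * kernel τ ρ (p, q) ∂(slab d α β)
        = h k q * ∫ p, absRegDD δ (u p - v q) * g k p * (τ p.1 q.1 * ρ (p.2 - q.2))
            ∂(slab d α β) := by
          rw [← integral_const_mul]
          congr 1
          funext p
          simp only [kernel]
          ring
      _ = h k q * -∫ p, ∑ i, P.β (fun s => absRegDD δ (s - v q)) i k (u p) *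
            (τ p.1 q.1 * dirDeriv i ρ (p.2 - q.2)) ∂(slab d α β) := by rw [key, neg_neg]
      _ = ∫ p, -∑ i, regPrim δ (P.σ i k) (u p) (v q) * h k q *
            kernel τ (dirDeriv i ρ) (p, q) ∂(slab d α β) := by
          rw [← integral_neg, ← integral_const_mul]
          congr 1
          funext p
          rw [mul_neg, Finset.mul_sum]
          congr 1
          refine Finset.sum_congr rfl fun i _ => ?_
          simp only [kernel, Coefficients.β, prim, regPrim]
          ring
  rw [step1]
  congr 1
  refine Finset.sum_congr rfl fun i _ => ?_
  unfold pairing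
  rw [← integral_finsetSum _ fun j _ => i2 i j]
  have i2' := integrable_finsetSum Finset.univ fun j _ => i2 i j
  have i1' := i1 i
  unfold slab₂ at i1' i2' ⊢
  rw [integral_prod _ i1', integral_prod _ i2']
  congr 1
  funext p
  -- Second chain rule, in y with (t,x) frozen: ψ is now the primitive produced by the first one.
  -- This is why the chain rule is required for general continuous ψ.
  have hψ : Continuous fun w => regPrim δ (P.σ i k) (u p) w :=
    (continuous_regPrim hδ (hσ i)).comp (f := fun w => (u p, w)) (by fun_prop)
  have key := hs'.chain _ hψ k (fun s => τ p.1 s) (fun w => dirDeriv i ρ (p.2 - w))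
    (hτ'.smooth p.1) ((hρ.dirDeriv i).comp_const_sub p.2) fun s hs => hτ'.supp s p.1 hs
  simp only [dirDeriv_comp_const_sub] at key
  calc ∫ q, regPrim δ (P.σ i k) (u p) (v q) * h k q * kernel τ (dirDeriv i ρ) (p, q)
        ∂(slab d α β)
      = -∫ q, ∑ j, P.β (fun w => regPrim δ (P.σ i k) (u p) w) j k (v q) *
          (τ p.1 q.1 * -dirDeriv j (dirDeriv i ρ) (p.2 - q.2)) ∂(slab d α β) := by
        rw [key, neg_neg]
        rfl
    _ = _ := by
        rw [← integral_neg]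
        congr 1
        funext q
        rw [← Finset.sum_neg_distrib]
        refine Finset.sum_congr rfl fun j _ => ?_
        simp only [kernel, Coefficients.β, prim, integral_regPrim_mul hδ (hσ i) (hσ j)]
        ring

/-- Relabelling i ↔ j aligns the order of the two derivatives of ρ in the mixed dissipation with
that in the diffusion term, so derivatives need not be commuted. -/
theorem sum_neg_sum_mul_two {n : ℕ} (F : Fin n → Fin n → Fin n → ℝ) :
    ∑ k, (-∑ i, ∑ j, F i j k) * 2 = -∑ i, ∑ j, 2 * ∑ k, F j i k := by
  rw [← Finset.sum_mul, Finset.sum_neg_distrib, neg_mul, mul_comm]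
  congr 1
  simp only [← Finset.mul_sum]
  congr 1
  calc ∑ k, ∑ i, ∑ j, F i j k = ∑ i, ∑ k, ∑ j, F i j k := Finset.sum_comm
    _ = ∑ i, ∑ j, ∑ k, F i j k := Finset.sum_congr rfl fun i _ => Finset.sum_comm
    _ = _ := Finset.sum_comm

/-- **Kruzhkov's inequality** for the kernels `τ(t,s) ρ(x-y)`: the spatial terms drop out. -/
theorem IsSlabSolution.kruzhkov (hs : IsSlabSolution P α β u g) (hs' : IsSlabSolution P α β v h)
    (hu : IsBoundedOn α β M u) (hv : IsBoundedOn α β M v)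
    (hτ : IsTimeKernel α β τ τ₁) (hτ' : IsTimeKernel α β (fun s t => τ t s) (fun s t => τ₂ t s))
    (hρ : IsTrig ρ) (hρ0 : ∀ w, 0 ≤ ρ w) :
    0 ≤ pairing α β u v (fun r s => |r - s|) τ₁ ρ + pairing α β u v (fun r s => |r - s|) τ₂ ρ := by
  have hτ₂ : Continuous τ₂.uncurry := hτ'.cont₁.comp continuous_swap
  have hdiss : ∀ δ > 0,
      0 ≤ pairing α β u v (fun r s => absReg δ (r - s)) τ₁ ρ
        + pairing α β u v (fun r s => absReg δ (r - s)) τ₂ ρ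
        + ∑ i, (pairing α β u v (regFlux δ (deriv (P.f i))) τ (dirDeriv i ρ)
          - pairing α β u v (fun r s => regFlux δ (deriv (P.f i)) s r) τ (dirDeriv i ρ))
        + ∑ i, ∑ j, (pairing α β u v (regFlux δ (deriv (P.A i j))) τ (dirDeriv i (dirDeriv j ρ))
          + pairing α β u v (fun r s => regFlux δ (deriv (P.A i j)) s r) τ
            (dirDeriv i (dirDeriv j ρ))
          + 2 * ∑ k, pairing α β u v (regDouble δ fun s w => P.σ j k s * P.σ i k w) τ
            (dirDeriv i (dirDeriv j ρ))) := by
    intro δ hδ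
    have h1 := hs.entropy_double hu hv hδ hτ hρ hρ0
    have h2 := hs'.entropy_double_snd hu hv hδ hτ' hρ hρ0
    have h3 := fun k => hs.cross_double hs' hu hv hδ hτ hτ' hρ k
    have hc := continuous_sub_comp (continuous_absRegDD hδ)
    have j1 := integrable_weight_kernel hu hv hc
      (w := fun z => ∑ k, g k z.1 ^ 2)
      ((integrable_finsetSum _ fun k _ => (hs.memLp k).integrable_sq).comp_fst _) hτ.cont hρ
    have j2 := integrable_weight_kernel hu hv hc
      (w := fun z => ∑ k, h k z.2 ^ 2)
      ((integrable_finsetSum _ fun k _ => (hs'.memLp k).integrable_sq).comp_snd _) hτ.cont hρ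
    have j3 := fun k => integrable_weight_kernel hu hv hc
      (w := fun z => g k z.1 * h k z.2)
      (((hs.memLp k).integrable (by norm_num)).mul_prod
        ((hs'.memLp k).integrable (by norm_num))) hτ.cont hρ
    -- Young's inequality 2 g_k h_k ≤ g_k² + h_k², weighted by η'' τ ρ ≥ 0: the two dissipations
    -- dominate the mixed one.
    have h4 : ∑ k, (∫ z, absRegDD δ (u z.1 - v z.2) * (g k z.1 * h k z.2) * kernel τ ρ z
        ∂(slab₂ d α β)) * 2 ≤
        ∫ z, absRegDD δ (u z.1 - v z.2) * (∑ k, g k z.1 ^ 2) * kernel τ ρ z ∂(slab₂ d α β) +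
        ∫ z, absRegDD δ (u z.1 - v z.2) * (∑ k, h k z.2 ^ 2) * kernel τ ρ z ∂(slab₂ d α β) := by
      rw [← integral_add j1 j2]
      simp only [← integral_mul_const]
      rw [← integral_finsetSum _ fun k _ => (j3 k).mul_const 2]
      refine integral_mono (integrable_finsetSum _ fun k _ => (j3 k).mul_const 2) (j1.add j2)
        fun z => ?_
      have hk : 0 ≤ kernel τ ρ z := mul_nonneg (hτ.nonneg _ _) (hρ0 _)
      have hd : 0 ≤ absRegDD δ (u z.1 - v z.2) := absRegDD_nonneg _
      have hsum : ∑ k, g k z.1 * h k z.2 * 2 ≤ ∑ k, g k z.1 ^ 2 + ∑ k, h k z.2 ^ 2 := by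
        rw [← Finset.sum_add_distrib]
        exact Finset.sum_le_sum fun k _ => by nlinarith [sq_nonneg (g k z.1 - h k z.2)]
      calc ∑ k, absRegDD δ (u z.1 - v z.2) * (g k z.1 * h k z.2) * kernel τ ρ z * 2
          = absRegDD δ (u z.1 - v z.2) * kernel τ ρ z * ∑ k, g k z.1 * h k z.2 * 2 := by
            rw [Finset.mul_sum]
            exact Finset.sum_congr rfl fun k _ => by ring
        _ ≤ absRegDD δ (u z.1 - v z.2) * kernel τ ρ z *
              (∑ k, g k z.1 ^ 2 + ∑ k, h k z.2 ^ 2) :=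
            mul_le_mul_of_nonneg_left hsum (mul_nonneg hd hk)
        _ = _ := by ring
    simp only [h3] at h4
    rw [sum_neg_sum_mul_two fun i j k => pairing α β u v
      (regDouble δ fun s w => P.σ i k s * P.σ j k w) τ (dirDeriv j (dirDeriv i ρ))] at h4
    simp only [Finset.sum_add_distrib, Finset.sum_sub_distrib]
    linarith
  have hflux : ∀ i, ∃ C, ∀ δ > 0,
      |pairing α β u v (regFlux δ (deriv (P.f i))) τ (dirDeriv i ρ)
        - pairing α β u v (fun r s => regFlux δ (deriv (P.f i)) s r) τ (dirDeriv i ρ)|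
        ≤ C * δ := by
    intro i
    have hF := P.contDiff_deriv_f i
    obtain ⟨L, -, hL⟩ := exists_regFlux_sub_bound hF M
    obtain ⟨C, hC0, hC⟩ := exists_pairing_bound hu hv hτ.cont (hρ.dirDeriv i)
    refine ⟨C * L, fun δ hδ => ?_⟩
    have hc := continuous_regFlux hδ hF.continuous
    have hcs : Continuous (Function.uncurry fun r s => regFlux δ (deriv (P.f i)) s r) :=
      hc.comp continuous_swap
    have hc0 : Continuous fun r => regFlux δ (deriv (P.f i)) r 0 :=
      hc.comp (f := fun r => (r, (0 : ℝ))) (by fun_prop)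
    have hc1 : Continuous (Function.uncurry fun r _ : ℝ => regFlux δ (deriv (P.f i)) r 0) :=
      hc0.comp continuous_fst
    have hc2 : Continuous (Function.uncurry fun _ r : ℝ => regFlux δ (deriv (P.f i)) r 0) :=
      hc0.comp continuous_snd
    have hb := hC (fun r s => regFlux δ (deriv (P.f i)) r s - regFlux δ (deriv (P.f i)) s r -
      (regFlux δ (deriv (P.f i)) r 0 - regFlux δ (deriv (P.f i)) s 0)) (L * δ) (hL δ hδ)
    have hs1 : Continuous (Function.uncurry fun r s =>
        regFlux δ (deriv (P.f i)) r s - regFlux δ (deriv (P.f i)) s r) := hc.sub hcs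
    have hs2 : Continuous (Function.uncurry fun r s =>
        regFlux δ (deriv (P.f i)) r 0 - regFlux δ (deriv (P.f i)) s 0) := hc1.sub hc2
    rw [pairing_sub hu hv hs1 hs2 hτ.cont (hρ.dirDeriv i),
      pairing_sub hu hv hc hcs hτ.cont (hρ.dirDeriv i),
      pairing_sub hu hv hc1 hc2 hτ.cont (hρ.dirDeriv i),
      pairing_fst_dirDeriv hu hv hc0 hτ.cont hρ, pairing_snd_dirDeriv hu hv hc0 hτ.cont hρ,
      sub_zero, sub_zero] at hb
    linarith
  have hdiff : ∀ i j, ∃ C, ∀ δ > 0,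
      |pairing α β u v (regFlux δ (deriv (P.A i j))) τ (dirDeriv i (dirDeriv j ρ))
        + pairing α β u v (fun r s => regFlux δ (deriv (P.A i j)) s r) τ
          (dirDeriv i (dirDeriv j ρ))
        + 2 * ∑ k, pairing α β u v (regDouble δ fun s w => P.σ j k s * P.σ i k w) τ
          (dirDeriv i (dirDeriv j ρ))| ≤ C * δ := by
    intro i j
    have hF := P.contDiff_deriv_A i j
    have hρ2 := (hρ.dirDeriv j).dirDeriv i
    obtain ⟨L, -, hL⟩ := exists_regFlux_add_bound hF (fun k => P.contDiff_σ j k)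
      (fun k => P.contDiff_σ i k) (fun s => by simp only [P.deriv_A, mul_comm]) M
    obtain ⟨C, hC0, hC⟩ := exists_pairing_bound hu hv hτ.cont hρ2
    refine ⟨C * L, fun δ hδ => ?_⟩
    have hc := continuous_regFlux hδ hF.continuous
    have hcs : Continuous (Function.uncurry fun r s => regFlux δ (deriv (P.A i j)) s r) :=
      hc.comp continuous_swap
    have hc0 : Continuous fun r => regFlux δ (deriv (P.A i j)) r 0 :=
      hc.comp (f := fun r => (r, (0 : ℝ))) (by fun_prop)
    have hc1 : Continuous (Function.uncurry fun r _ : ℝ => regFlux δ (deriv (P.A i j)) r 0) :=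
      hc0.comp continuous_fst
    have hc2 : Continuous (Function.uncurry fun _ r : ℝ => regFlux δ (deriv (P.A i j)) r 0) :=
      hc0.comp continuous_snd
    have hd : ∀ k, Continuous (regDouble δ fun s w => P.σ j k s * P.σ i k w).uncurry := fun k =>
      continuous_regDouble hδ <| by
        have := (P.contDiff_σ i k).continuous
        have := (P.contDiff_σ j k).continuous
        simp only [Function.uncurry_def]; fun_prop
    have hds : Continuous (Function.uncurry fun r s =>
        ∑ k, regDouble δ (fun s w => P.σ j k s * P.σ i k w) r s) := by
      simp only [Function.uncurry_def]
      exact continuous_finsetSum _ fun k _ => hd k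
    have hds2 : Continuous (Function.uncurry fun r s =>
        2 * ∑ k, regDouble δ (fun s w => P.σ j k s * P.σ i k w) r s) :=
      (continuous_const (y := (2 : ℝ))).mul hds
    have hb := hC (fun r s => regFlux δ (deriv (P.A i j)) r s + regFlux δ (deriv (P.A i j)) s r
      + 2 * ∑ k, regDouble δ (fun s w => P.σ j k s * P.σ i k w) r s
      - (regFlux δ (deriv (P.A i j)) r 0 + regFlux δ (deriv (P.A i j)) s 0)) (L * δ) (hL δ hδ)
    have hs1 : Continuous (Function.uncurry fun r s =>
        regFlux δ (deriv (P.A i j)) r s + regFlux δ (deriv (P.A i j)) s r) := hc.add hcs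
    have hs2 : Continuous (Function.uncurry fun r s =>
        regFlux δ (deriv (P.A i j)) r 0 + regFlux δ (deriv (P.A i j)) s 0) := hc1.add hc2
    have hs3 : Continuous (Function.uncurry fun r s =>
        regFlux δ (deriv (P.A i j)) r s + regFlux δ (deriv (P.A i j)) s r
        + 2 * ∑ k, regDouble δ (fun s w => P.σ j k s * P.σ i k w) r s) := hs1.add hds2
    rw [pairing_sub hu hv hs3 hs2 hτ.cont hρ2,
      pairing_add hu hv hs1 hds2 hτ.cont hρ2,
      pairing_add hu hv hc hcs hτ.cont hρ2, pairing_const_mul,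
      pairing_sum hu hv _ hd hτ.cont hρ2,
      pairing_add hu hv hc1 hc2 hτ.cont hρ2,
      pairing_fst_dirDeriv hu hv hc0 hτ.cont (hρ.dirDeriv j),
      pairing_snd_dirDeriv hu hv hc0 hτ.cont (hρ.dirDeriv j),
      add_zero, sub_zero] at hb
    linarith
  have habs : ∀ κ : ℝ → ℝ → ℝ, Continuous κ.uncurry → ∃ C, ∀ δ > 0,
      |pairing α β u v (fun r s => absReg δ (r - s)) κ ρ
        - pairing α β u v (fun r s => |r - s|) κ ρ| ≤ C * δ := by
    intro κ hκ
    obtain ⟨C, hC0, hC⟩ := exists_pairing_bound hu hv hκ hρ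
    refine ⟨C, fun δ hδ => ?_⟩
    rw [← pairing_sub hu hv (continuous_sub_comp continuous_absReg)
      (continuous_sub_comp continuous_abs) hκ hρ]
    refine hC _ δ fun r s _ _ => ?_
    rw [abs_of_nonneg (sub_nonneg.2 (abs_le_absReg _))]
    linarith [absReg_le hδ (r - s)]
  choose C₁ hC₁ using hflux
  choose C₂ hC₂ using hdiff
  obtain ⟨C₃, hC₃⟩ := habs τ₁ hτ.cont₁
  obtain ⟨C₄, hC₄⟩ := habs τ₂ hτ₂
  -- All constants are independent of δ, so the total error is a fixed multiple of δ.
  have hfin : ∀ δ > 0, 0 ≤ pairing α β u v (fun r s => |r - s|) τ₁ ρ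
      + pairing α β u v (fun r s => |r - s|) τ₂ ρ
      + (C₃ + C₄ + ∑ i, C₁ i + ∑ i, ∑ j, C₂ i j) * δ := by
    intro δ hδ
    have h0 := hdiss δ hδ
    have h3 := (abs_le.1 (hC₃ δ hδ)).2
    have h4 := (abs_le.1 (hC₄ δ hδ)).2
    have h1 := Finset.sum_le_sum fun i (_ : i ∈ Finset.univ) => (abs_le.1 (hC₁ i δ hδ)).2
    have h2 := Finset.sum_le_sum fun i (_ : i ∈ Finset.univ) =>
      Finset.sum_le_sum fun j (_ : j ∈ Finset.univ) => (abs_le.1 (hC₂ i j δ hδ)).2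
    simp only [← Finset.sum_mul] at h1 h2
    linarith
  have hlim : Tendsto (fun δ : ℝ => pairing α β u v (fun r s => |r - s|) τ₁ ρ
      + pairing α β u v (fun r s => |r - s|) τ₂ ρ
      + (C₃ + C₄ + ∑ i, C₁ i + ∑ i, ∑ j, C₂ i j) * δ) (𝓝[>] 0)
      (𝓝 (pairing α β u v (fun r s => |r - s|) τ₁ ρ
        + pairing α β u v (fun r s => |r - s|) τ₂ ρ)) := by
    refine tendsto_nhdsWithin_of_tendsto_nhds ?_
    refine Continuous.tendsto' (by fun_prop) _ _ (by simp)
  exact ge_of_tendsto hlim (eventually_mem_nhdsWithin.mono fun δ hδ => hfin δ hδ)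

end

/-- Regularity gives the density of continuous functions in L¹ of the Haar measure. -/
instance (d : ℕ) : (haar d).Regular := inferInstanceAs (Measure.addHaarMeasure ⊤).Regular

/-! ### Trigonometric approximations of the identity -/

/-- Characters separate each point of `K` from 0, so (1 + cos)/2 of a suitable character is 1 at 0
and less than 1 near that point. By compactness finitely many such factors suffice, and a product is
at most each of its factors because all lie in [0,1]. -/
theorem exists_trig_peak {K : Set (BohrCompact d)} (hK : IsCompact K)
    (h0 : (0 : BohrCompact d) ∉ K) :
    ∃ g : BohrCompact d → ℝ, IsTrig g ∧ (∀ w, 0 ≤ g w) ∧ (∀ w, g w ≤ 1) ∧ g 0 = 1 ∧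
      ∃ c, 0 ≤ c ∧ c < 1 ∧ ∀ w ∈ K, g w ≤ c := by
  refine hK.induction_on (p := fun S => ∃ g : BohrCompact d → ℝ, IsTrig g ∧ (∀ w, 0 ≤ g w) ∧
    (∀ w, g w ≤ 1) ∧ g 0 = 1 ∧ ∃ c, 0 ≤ c ∧ c < 1 ∧ ∀ w ∈ S, g w ≤ c) ?_ ?_ ?_ ?_
  · exact ⟨fun _ => 1, .const 1, fun _ => zero_le_one, fun _ => le_rfl, rfl, 0, le_rfl,
      zero_lt_one, fun w hw => hw.elim⟩
  · rintro s t hst ⟨g, h1, h2, h3, h4, c, h5, h6, h7⟩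
    exact ⟨g, h1, h2, h3, h4, c, h5, h6, fun w hw => h7 w (hst hw)⟩
  · rintro s t ⟨g, h1, h2, h3, h4, c, h5, h6, h7⟩ ⟨g', h1', h2', h3', h4', c', h5', h6', h7'⟩
    refine ⟨_, h1.mul h1', fun w => mul_nonneg (h2 w) (h2' w),
      fun w => mul_le_one₀ (h3 w) (h2' w) (h3' w), by rw [h4, h4', one_mul], max c c',
      le_max_of_le_left h5, max_lt h6 h6', ?_⟩
    rintro w (hw | hw)
    · calc g w * g' w ≤ g w * 1 := mul_le_mul_of_nonneg_left (h3' w) (h2 w)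
        _ ≤ _ := by rw [mul_one]; exact (h7 w hw).trans (le_max_left _ _)
    · calc g w * g' w ≤ 1 * g' w := mul_le_mul_of_nonneg_right (h3 w) (h2' w)
        _ ≤ _ := by rw [one_mul]; exact (h7' w hw).trans (le_max_right _ _)
  · intro x hx
    obtain ⟨l, hl⟩ := exists_character_ne_zero (w := x) fun h => h0 (h ▸ hx)
    set g : BohrCompact d → ℝ := fun w => 1 / 2 * (1 + circleCos (character l w + 0)) with hg
    have hgt : IsTrig g := ((IsTrig.const 1).add (.cosine l 0)).const_mul _
    have hx1 : g x < 1 := by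
      have := circleCos_lt_one hl
      simp only [hg, add_zero]
      linarith
    obtain ⟨c, hc1, hc2⟩ := exists_between hx1
    have hg0 : ∀ w, 0 ≤ g w := fun w => by
      have := neg_one_le_circleCos (character l w + 0)
      simp only [hg]
      linarith
    refine ⟨{w | g w < c}, mem_nhdsWithin_of_mem_nhds
      ((isOpen_lt hgt.continuous continuous_const).mem_nhds hc1), g, hgt, hg0, fun w => ?_, ?_, c,
      (hg0 x).trans hc1.le, hc2, fun w hw => le_of_lt hw⟩
    · have := circleCos_le_one (character l w + 0)
      simp only [hg]
      linarith
    · simp only [hg, character_zero, add_zero, circleCos_zero]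
      norm_num

/-- High powers of a peak function concentrate at its peak, so a normalized power serves as the
kernel. -/
theorem exists_trig_kernel {N : Set (BohrCompact d)} (hN : IsOpen N)
    (h0 : (0 : BohrCompact d) ∈ N) {ε : ℝ} (hε : 0 < ε) :
    ∃ ρ : BohrCompact d → ℝ, IsTrig ρ ∧ (∀ w, 0 ≤ ρ w) ∧ ∫ w, ρ w ∂(haar d) = 1 ∧
      ∫ w in Nᶜ, ρ w ∂(haar d) ≤ ε := by
  obtain ⟨g, hg, hg0, hg1, hgz, c, hc0, hc1, hc⟩ := exists_trig_peak hN.isClosed_compl.isCompact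
    (fun h => h h0)
  -- With `c < c' < 1`, the integral of gⁿ outside `N` is at most cⁿ, while the full integral is at
  -- least c'ⁿ times the positive measure of {g > c'}. Their ratio decays like (c/c')ⁿ.
  obtain ⟨c', hcc', hc'1⟩ := exists_between hc1
  have hc'0 : 0 < c' := hc0.trans_lt hcc'
  set U : Set (BohrCompact d) := {w | c' < g w} with hU
  have hUo : IsOpen U := isOpen_lt continuous_const hg.continuous
  have hUpos : 0 < (haar d).real U := by
    refine ENNReal.toReal_pos (hUo.measure_pos _ ⟨0, ?_⟩).ne' (measure_ne_top _ _)
    simpa [hU, hgz] using hc'1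
  have hlow : ∀ n : ℕ, c' ^ n * (haar d).real U ≤ ∫ w, g w ^ n ∂(haar d) := by
    intro n
    have hint := integrable_of_continuous (hg.pow n).continuous
    calc c' ^ n * (haar d).real U = ∫ w in U, c' ^ n ∂(haar d) := by
          rw [setIntegral_const, smul_eq_mul, mul_comm]
      _ ≤ ∫ w in U, g w ^ n ∂(haar d) :=
          setIntegral_mono_on (integrable_const _).integrableOn hint.integrableOn
            hUo.measurableSet fun w hw => pow_le_pow_left₀ hc'0.le (le_of_lt hw) n
      _ ≤ _ := setIntegral_le_integral hint (Eventually.of_forall fun w => pow_nonneg (hg0 w) n)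
  have hup : ∀ n : ℕ, ∫ w in Nᶜ, g w ^ n ∂(haar d) ≤ c ^ n := by
    intro n
    have hint := integrable_of_continuous (hg.pow n).continuous
    calc ∫ w in Nᶜ, g w ^ n ∂(haar d) ≤ ∫ w in Nᶜ, c ^ n ∂(haar d) :=
          setIntegral_mono_on hint.integrableOn (integrable_const _).integrableOn
            hN.isClosed_compl.measurableSet fun w hw => pow_le_pow_left₀ (hg0 w) (hc w hw) n
      _ = (haar d).real Nᶜ * c ^ n := by rw [setIntegral_const, smul_eq_mul]
      _ ≤ 1 * c ^ n := mul_le_mul_of_nonneg_right measureReal_le_one (pow_nonneg hc0 n)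
      _ = c ^ n := one_mul _
  have hlim : Tendsto (fun n : ℕ => (c / c') ^ n) atTop (𝓝 0) :=
    tendsto_pow_atTop_nhds_zero_of_lt_one (by positivity) ((div_lt_one hc'0).2 hcc')
  obtain ⟨n, hn⟩ := (hlim.eventually (gt_mem_nhds (mul_pos hε hUpos))).exists
  have hI : 0 < ∫ w, g w ^ n ∂(haar d) :=
    (mul_pos (pow_pos hc'0 n) hUpos).trans_le (hlow n)
  refine ⟨fun w => (∫ w, g w ^ n ∂(haar d))⁻¹ * g w ^ n, (hg.pow n).const_mul _,
    fun w => mul_nonneg (inv_nonneg.2 hI.le) (pow_nonneg (hg0 w) n), ?_, ?_⟩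
  · rw [integral_const_mul, inv_mul_cancel₀ hI.ne']
  · rw [integral_const_mul, inv_mul_le_iff₀ hI]
    calc ∫ w in Nᶜ, g w ^ n ∂(haar d) ≤ c ^ n := hup n
      _ = c' ^ n * (c / c') ^ n := by rw [div_pow]; field_simp
      _ ≤ c' ^ n * (ε * (haar d).real U) := by gcongr
      _ = c' ^ n * (haar d).real U * ε := by ring
      _ ≤ _ := mul_le_mul_of_nonneg_right (hlow n) hε.le

/-! ### Density of continuous functions in `L¹` of a slab -/

/-- Continuity on ℝ × G implies measurability for the product σ-algebra because ℝ is second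
countable. -/
theorem integrable_slab_of_continuous {W : ℝ × BohrCompact d → ℝ} (hW : Continuous W) :
    Integrable W (slab d α β) := by
  obtain ⟨C, hC⟩ := ((isCompact_Icc (a := α) (b := β)).prod
    (isCompact_univ (X := BohrCompact d))).exists_bound_of_continuousOn hW.continuousOn
  refine Integrable.of_bound hW.measurable.aestronglyMeasurable C ?_
  filter_upwards [ae_slab_fst_mem] with p hp using hC p ⟨hp, trivial⟩

/-- `V` is a limit of continuous functions in `L¹` of the slab. -/
def IsContApprox (α β : ℝ) (V : ℝ × BohrCompact d → ℝ) : Prop :=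
  ∀ ε > 0, ∃ W : ℝ × BohrCompact d → ℝ, Continuous W ∧ ∫ p, |V p - W p| ∂(slab d α β) ≤ ε

theorem IsContApprox.of_approx {V : ℝ × BohrCompact d → ℝ} (hV : Integrable V (slab d α β))
    (h : ∀ ε > 0, ∃ V', Integrable V' (slab d α β) ∧ IsContApprox α β V' ∧
      ∫ p, |V p - V' p| ∂(slab d α β) ≤ ε) : IsContApprox α β V := by
  intro ε hε
  obtain ⟨V', hV', h1, h2⟩ := h (ε / 2) (half_pos hε)
  obtain ⟨W, hW, h3⟩ := h1 (ε / 2) (half_pos hε)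
  refine ⟨W, hW, ?_⟩
  have hWi := integrable_slab_of_continuous (α := α) (β := β) hW
  calc ∫ p, |V p - W p| ∂(slab d α β)
      ≤ ∫ p, (|V p - V' p| + |V' p - W p|) ∂(slab d α β) :=
        integral_mono (hV.sub hWi).abs ((hV.sub hV').abs.add (hV'.sub hWi).abs)
          fun p => abs_sub_le _ _ _
    _ = _ := integral_add (hV.sub hV').abs (hV'.sub hWi).abs
    _ ≤ ε := by linarith

theorem IsContApprox.add {V V' : ℝ × BohrCompact d → ℝ} (hV : Integrable V (slab d α β))
    (hV' : Integrable V' (slab d α β)) (h : IsContApprox α β V) (h' : IsContApprox α β V') :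
    IsContApprox α β (V + V') := by
  intro ε hε
  obtain ⟨W, hW, h1⟩ := h (ε / 2) (half_pos hε)
  obtain ⟨W', hW', h2⟩ := h' (ε / 2) (half_pos hε)
  refine ⟨W + W', hW.add hW', ?_⟩
  have hWi := integrable_slab_of_continuous (α := α) (β := β) hW
  have hWi' := integrable_slab_of_continuous (α := α) (β := β) hW'
  calc ∫ p, |(V + V') p - (W + W') p| ∂(slab d α β)
      ≤ ∫ p, (|V p - W p| + |V' p - W' p|) ∂(slab d α β) :=
        integral_mono ((hV.add hV').sub (hWi.add hWi')).abs
          ((hV.sub hWi).abs.add (hV'.sub hWi').abs) fun p => by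
            simp only [Pi.add_apply]
            rw [add_sub_add_comm]
            exact abs_add_le _ _
    _ = _ := integral_add (hV.sub hWi).abs (hV'.sub hWi').abs
    _ ≤ ε := by linarith

theorem IsContApprox.const_mul {V : ℝ × BohrCompact d → ℝ} (h : IsContApprox α β V) (c : ℝ) :
    IsContApprox α β fun p => c * V p := by
  intro ε hε
  obtain ⟨W, hW, h1⟩ := h (ε / (|c| + 1)) (by positivity)
  refine ⟨fun p => c * W p, continuous_const.mul hW, ?_⟩
  simp only [← mul_sub, abs_mul]
  rw [integral_const_mul]
  calc |c| * ∫ p, |V p - W p| ∂(slab d α β) ≤ |c| * (ε / (|c| + 1)) := by gcongr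
    _ ≤ (|c| + 1) * (ε / (|c| + 1)) := by gcongr; linarith
    _ = ε := by field_simp

theorem IsContApprox.congr_ae {V V' : ℝ × BohrCompact d → ℝ} (h : IsContApprox α β V)
    (hVV' : V =ᵐ[slab d α β] V') : IsContApprox α β V' := by
  intro ε hε
  obtain ⟨W, hW, h1⟩ := h ε hε
  refine ⟨W, hW, (le_of_eq (integral_congr_ae ?_)).trans h1⟩
  filter_upwards [hVV'] with p hp
  rw [hp]

theorem isContApprox_rectangle {A : Set ℝ} {B : Set (BohrCompact d)} (hA : MeasurableSet A)
    (hB : MeasurableSet B) :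
    IsContApprox α β ((A ×ˢ B).indicator fun _ => 1) := by
  intro ε hε
  have hA1 : Integrable (A.indicator fun _ => (1 : ℝ)) (volume.restrict (Set.Icc α β)) :=
    (integrable_const _).indicator hA
  have hB1 : Integrable (B.indicator fun _ => (1 : ℝ)) (haar d) :=
    (integrable_const _).indicator hB
  obtain ⟨a, ha, hai⟩ := hA1.exists_boundedContinuous_integral_sub_le (half_pos hε)
  set Ca := ∫ t in Set.Icc α β, |a t| with hCa
  have hCa0 : 0 ≤ Ca := integral_nonneg fun t => abs_nonneg _
  -- The tolerance for the spatial factor depends on the L¹ norm of the time factor already chosen;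
  -- the added 1 avoids division by zero.
  obtain ⟨b, hb, hbi⟩ := hB1.exists_boundedContinuous_integral_sub_le
    (ε := ε / 2 / (Ca + 1)) (by positivity)
  have hprod : ∀ p : ℝ × BohrCompact d, (A ×ˢ B).indicator (fun _ => (1 : ℝ)) p =
      A.indicator (fun _ => 1) p.1 * B.indicator (fun _ => 1) p.2 := fun p => by
    by_cases h1 : p.1 ∈ A <;> by_cases h2 : p.2 ∈ B <;> simp [Set.indicator, h1, h2]
  refine ⟨fun p => a p.1 * b p.2, (a.continuous.comp continuous_fst).mul
    (b.continuous.comp continuous_snd), ?_⟩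
  have j1 : Integrable (fun p : ℝ × BohrCompact d =>
      |A.indicator (fun _ => (1 : ℝ)) p.1 - a p.1| * 1) (slab d α β) :=
    (hA1.sub hai).abs.mul_prod (integrable_const 1)
  have j2 : Integrable (fun p : ℝ × BohrCompact d =>
      |a p.1| * |B.indicator (fun _ => (1 : ℝ)) p.2 - b p.2|) (slab d α β) :=
    hai.abs.mul_prod (hB1.sub hbi).abs
  have j0 : Integrable (fun p => (A ×ˢ B).indicator (fun _ => (1 : ℝ)) p - a p.1 * b p.2)
      (slab d α β) := ((integrable_const _).indicator (hA.prod hB)).sub (hai.mul_prod hbi)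
  calc ∫ p, |(A ×ˢ B).indicator (fun _ => (1 : ℝ)) p - a p.1 * b p.2| ∂(slab d α β)
      ≤ ∫ p, (|A.indicator (fun _ => (1 : ℝ)) p.1 - a p.1| * 1 +
          |a p.1| * |B.indicator (fun _ => (1 : ℝ)) p.2 - b p.2|) ∂(slab d α β) := by
        refine integral_mono j0.abs (j1.add j2) fun p => ?_
        simp only [hprod]
        rw [show A.indicator (fun _ => (1 : ℝ)) p.1 * B.indicator (fun _ => 1) p.2 - a p.1 * b p.2 =
          (A.indicator (fun _ => (1 : ℝ)) p.1 - a p.1) * B.indicator (fun _ => 1) p.2 +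
          a p.1 * (B.indicator (fun _ => (1 : ℝ)) p.2 - b p.2) by ring]
        refine (abs_add_le _ _).trans ?_
        rw [abs_mul, abs_mul]
        refine add_le_add (mul_le_mul_of_nonneg_left ?_ (abs_nonneg _)) le_rfl
        by_cases h2 : p.2 ∈ B <;> simp [Set.indicator, h2]
    _ = (∫ t in Set.Icc α β, |A.indicator (fun _ => (1 : ℝ)) t - a t|) * 1 +
          Ca * ∫ x, |B.indicator (fun _ => (1 : ℝ)) x - b x| ∂(haar d) := by
        rw [integral_add j1 j2, slab, integral_prod_mul (fun t => |A.indicator _ t - a t|)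
          fun _ => (1 : ℝ), integral_prod_mul (fun t => |a t|) fun x => |B.indicator _ x - b x|]
        simp [hCa]
    _ ≤ ε / 2 * 1 + (Ca + 1) * (ε / 2 / (Ca + 1)) := by
        refine add_le_add (mul_le_mul_of_nonneg_right ha zero_le_one) ?_
        exact mul_le_mul (by linarith) hb (integral_nonneg fun _ => abs_nonneg _) (by linarith)
    _ = ε := by field_simp; ring

/-- Dynkin's π-λ argument starting from rectangles, which generate the product σ-algebra. Working
with this σ-algebra reduces the density to that of each factor. -/
theorem isContApprox_indicator {S : Set (ℝ × BohrCompact d)} (hS : MeasurableSet S) :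
    IsContApprox α β (S.indicator fun _ => 1) := by
  refine MeasurableSpace.induction_on_inter
    (C := fun S _ => IsContApprox α β (S.indicator fun _ => (1 : ℝ)))
    generateFrom_prod.symm isPiSystem_prod ?_ ?_ ?_ ?_ S hS
  · intro ε hε
    exact ⟨fun _ => 0, continuous_const, by simpa using hε.le⟩
  · rintro _ ⟨A, hA, B, hB, rfl⟩
    exact isContApprox_rectangle hA hB
  · intro T hT h ε hε
    obtain ⟨W, hW, h1⟩ := h ε hε
    refine ⟨fun p => 1 - W p, continuous_const.sub hW, le_trans (le_of_eq ?_) h1⟩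
    congr 1
    funext p
    rw [← abs_neg]
    by_cases hp : p ∈ T <;> simp [Set.indicator, hp]
  · intro f hd hf h
    have hind : ∀ T : Set (ℝ × BohrCompact d), MeasurableSet T →
        Integrable (T.indicator fun _ => (1 : ℝ)) (slab d α β) := fun T hT =>
      (integrable_const _).indicator hT
    refine IsContApprox.of_approx (hind _ (.iUnion hf)) fun ε hε => ?_
    have hfin : ∀ n, IsContApprox α β ((⋃ i ∈ Finset.range n, f i).indicator fun _ => (1 : ℝ)) := by
      intro n
      induction n with
      | zero => exact fun ε hε => ⟨fun _ => 0, continuous_const, by simpa using hε.le⟩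
      | succ n ih =>
        have hm : MeasurableSet (⋃ i ∈ Finset.range n, f i) :=
          Finset.measurableSet_biUnion _ fun i _ => hf i
        have hdis : Disjoint (f n) (⋃ i ∈ Finset.range n, f i) := by
          simp only [Set.disjoint_iUnion_right]
          exact fun i hi => hd (Finset.mem_range.1 hi).ne'
        rw [Finset.range_add_one, Finset.set_biUnion_insert, Set.indicator_union_of_disjoint hdis]
        exact IsContApprox.add (hind _ (hf n)) (hind _ hm) (h n) ih
    have hlim := tendsto_measure_iUnion_accumulate (μ := slab d α β) (f := f)
    have hacc : ∀ n, Set.accumulate f n = ⋃ i ∈ Finset.range (n + 1), f i := fun n => by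
      ext p
      simp [Set.mem_accumulate]
    have hlim' : Tendsto (fun n => (slab d α β).real (Set.accumulate f n)) atTop
        (𝓝 ((slab d α β).real (⋃ i, f i))) :=
      (ENNReal.tendsto_toReal (measure_ne_top _ _)).comp hlim
    obtain ⟨n, hn⟩ := (hlim'.eventually (lt_mem_nhds (sub_lt_self _ hε))).exists
    refine ⟨_, hind _ (Finset.measurableSet_biUnion _ fun i _ => hf i), hfin (n + 1), ?_⟩
    have hsub : (⋃ i ∈ Finset.range (n + 1), f i) ⊆ ⋃ i, f i :=
      Set.iUnion₂_subset fun i _ => Set.subset_iUnion f i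
    have hm : MeasurableSet (⋃ i ∈ Finset.range (n + 1), f i) :=
      Finset.measurableSet_biUnion _ fun i _ => hf i
    have habs : ∀ p, |(⋃ i, f i).indicator (fun _ => (1 : ℝ)) p -
        (⋃ i ∈ Finset.range (n + 1), f i).indicator (fun _ => 1) p| =
        (⋃ i, f i).indicator (fun _ => (1 : ℝ)) p -
        (⋃ i ∈ Finset.range (n + 1), f i).indicator (fun _ => 1) p := fun p =>
      abs_of_nonneg (sub_nonneg.2 (Set.indicator_le_indicator_of_subset hsub
        (fun _ => zero_le_one) p))
    simp only [habs]
    rw [integral_sub (hind _ (.iUnion hf)) (hind _ hm), integral_indicator (.iUnion hf),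
      integral_indicator hm, setIntegral_const, setIntegral_const, ← hacc]
    simp only [smul_eq_mul, mul_one]
    linarith

theorem isContApprox_of_integrable {V : ℝ × BohrCompact d → ℝ} (hV : Integrable V (slab d α β)) :
    IsContApprox α β V := by
  refine Integrable.induction (IsContApprox α β) ?_ ?_ ?_ ?_ hV
  · intro c s hs _
    convert (isContApprox_indicator (α := α) (β := β) hs).const_mul c using 2 with p
    by_cases hp : p ∈ s <;> simp [Set.indicator, hp]
  · intro f g _ hf hg h1 h2
    exact h1.add hf hg h2
  · refine isClosed_of_closure_subset fun f hf => ?_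
    refine IsContApprox.of_approx (L1.integrable_coeFn f) fun ε hε => ?_
    obtain ⟨g, hg, hfg⟩ := Metric.mem_closure_iff.1 hf ε hε
    refine ⟨g, L1.integrable_coeFn g, hg, ?_⟩
    rw [dist_eq_norm, L1.norm_eq_integral_norm] at hfg
    refine le_trans (le_of_eq (integral_congr_ae ?_)) hfg.le
    filter_upwards [Lp.coeFn_sub f g] with p hp
    rw [hp]
    rfl
  · intro f g hfg _ h
    exact h.congr_ae hfg

/-! ### Mollification in time and space -/

/-- An even mollifier on the line supported in `[-h, h]`. -/
structure IsMollifier (h : ℝ) (κ : ℝ → ℝ) : Prop where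
  smooth : ContDiff ℝ ∞ κ
  nonneg : ∀ t, 0 ≤ κ t
  supp : ∀ t, h ≤ |t| → κ t = 0
  integral_eq : ∫ t, κ t = 1
  even : ∀ t, κ (-t) = κ t

theorem isMollifier_normed (φ : ContDiffBump (0 : ℝ)) :
    IsMollifier φ.rOut (φ.normed volume) where
  smooth := φ.contDiff_normed
  nonneg := φ.nonneg_normed
  supp t ht := by
    by_contra h0
    have : t ∈ Function.support (φ.normed volume) := h0
    rw [φ.support_normed_eq, Metric.mem_ball, dist_zero_right, Real.norm_eq_abs] at this
    linarith
  integral_eq := φ.integral_normed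
  even := φ.normed_neg

theorem exists_isMollifier {h : ℝ} (hh : 0 < h) : ∃ κ, IsMollifier h κ :=
  ⟨_, isMollifier_normed ⟨h / 2, h, by positivity, by linarith⟩⟩

namespace IsMollifier

variable {h : ℝ} {κ : ℝ → ℝ}

theorem continuous (hκ : IsMollifier h κ) : Continuous κ := hκ.smooth.continuous

theorem integrable (hκ : IsMollifier h κ) : Integrable κ :=
  not_imp_comm.1 integral_undef (by rw [hκ.integral_eq]; exact one_ne_zero)

theorem setIntegral_sub_left_le (hκ : IsMollifier h κ) (S : Set ℝ) (t : ℝ) :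
    ∫ s in S, κ (t - s) ≤ 1 := by
  refine (setIntegral_le_integral (hκ.integrable.comp_sub_left t)
    (Eventually.of_forall fun s => hκ.nonneg _)).trans (le_of_eq ?_)
  rw [integral_sub_left_eq_self κ volume t, hκ.integral_eq]

theorem setIntegral_sub_right_le (hκ : IsMollifier h κ) (S : Set ℝ) (s : ℝ) :
    ∫ t in S, κ (t - s) ≤ 1 := by
  refine (setIntegral_le_integral (hκ.integrable.comp_sub_right s)
    (Eventually.of_forall fun t => hκ.nonneg _)).trans (le_of_eq ?_)
  rw [integral_sub_right_eq_self κ s, hκ.integral_eq]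

theorem setIntegral_sub_left_eq (hκ : IsMollifier h κ) {t : ℝ}
    (ht : t ∈ Set.Icc (α + h) (β - h)) : ∫ s in Set.Icc α β, κ (t - s) = 1 := by
  rw [setIntegral_eq_integral_of_forall_compl_eq_zero, integral_sub_left_eq_self κ volume t,
    hκ.integral_eq]
  intro s hs
  refine hκ.supp _ ?_
  by_contra! hlt
  rw [abs_lt] at hlt
  exact hs ⟨by linarith [ht.1], by linarith [ht.2]⟩

theorem continuous_kernel (hκ : IsMollifier h κ) :
    Continuous (Function.uncurry fun t s : ℝ => κ (t - s)) :=
  continuous_sub_comp hκ.continuous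

end IsMollifier

section

variable {κ : ℝ → ℝ} {h : ℝ} {ρ : BohrCompact d → ℝ}

theorem integral_kernel_snd (p : ℝ × BohrCompact d) (hρ1 : ∫ w, ρ w ∂(haar d) = 1) :
    ∫ q, kernel (fun t s => κ (t - s)) ρ (p, q) ∂(slab d α β) =
      ∫ s in Set.Icc α β, κ (p.1 - s) := by
  simp only [kernel, slab]
  rw [integral_prod_mul (fun s => κ (p.1 - s)) fun y => ρ (p.2 - y),
    integral_sub_left_eq_self ρ (haar d) p.2, hρ1, mul_one]

theorem integral_kernel_fst (q : ℝ × BohrCompact d) (f : BohrCompact d → ℝ) :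
    ∫ p, kernel (fun t s => κ (t - s)) f (p, q) ∂(slab d α β) =
      (∫ t in Set.Icc α β, κ (t - q.1)) * ∫ w, f w ∂(haar d) := by
  simp only [kernel, slab]
  rw [integral_prod_mul (fun t => κ (t - q.1)) fun x => f (x - q.2),
    integral_sub_right_eq_self f q.2]

theorem integrable_mul_kernel {w : (ℝ × BohrCompact d) × (ℝ × BohrCompact d) → ℝ}
    (hw : Integrable w (slab₂ d α β)) {κ : ℝ → ℝ → ℝ} (hκ : Continuous κ.uncurry)
    (hρ : IsTrig ρ) : Integrable (fun z => w z * kernel κ ρ z) (slab₂ d α β) := by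
  obtain ⟨C, -, hC⟩ := exists_kernel_bound (α := α) (β := β) hκ hρ
  exact hw.mul_bdd (measurable_kernel hκ hρ).aestronglyMeasurable hC

theorem IsBoundedOn.integrable {M : ℝ} {v : ℝ × BohrCompact d → ℝ} (hv : IsBoundedOn α β M v) :
    Integrable v (slab d α β) := Integrable.of_bound hv.meas M hv.bound

/-- Convolution kernels do not move continuous functions much. -/
theorem exists_continuous_mollification {W : ℝ × BohrCompact d → ℝ} (hW : Continuous W)
    {ε : ℝ} (hε : 0 < ε) :
    ∃ ρ : BohrCompact d → ℝ, IsTrig ρ ∧ (∀ w, 0 ≤ ρ w) ∧ ∫ w, ρ w ∂(haar d) = 1 ∧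
      ∃ h₀ > 0, ∀ h ≤ h₀, ∀ κ, IsMollifier h κ →
        ∀ᵐ q ∂(slab d α β),
          ∫ p, |W p - W q| * kernel (fun t s => κ (t - s)) ρ (p, q) ∂(slab d α β) ≤ ε := by
  have hK : IsCompact (Set.Icc α β ×ˢ (Set.univ : Set (BohrCompact d))) :=
    isCompact_Icc.prod isCompact_univ
  obtain ⟨C, hC⟩ := hK.exists_bound_of_continuousOn hW.continuousOn
  have hC' : ∀ p : ℝ × BohrCompact d, p.1 ∈ Set.Icc α β → |W p| ≤ |C| := fun p hp =>
    (hC p ⟨hp, trivial⟩).trans (le_abs_self C)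
  -- The tube lemma around the compact slab times {0} supplies uniform continuity: one neighbourhood
  -- of 0 serves every base point `q`.
  have hFc : Continuous fun z : (ℝ × BohrCompact d) × (ℝ × BohrCompact d) =>
      |W (z.1 + z.2) - W z.1| := by fun_prop
  obtain ⟨U, V, -, hV, hKU, h0V, hUV⟩ := generalized_tube_lemma hK
    (isCompact_singleton (x := (0 : ℝ × BohrCompact d)))
    (isOpen_lt hFc (continuous_const (y := ε / 2))) (by
      rintro ⟨q, z⟩ ⟨-, hz⟩
      have hz : z = 0 := hz
      show |W (q + z) - W q| < ε / 2
      rw [hz, add_zero, sub_self, abs_zero]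
      exact half_pos hε)
  obtain ⟨I, N, hI, hN, h0I, h0N, hIN⟩ := isOpen_prod_iff.1 hV 0 0 (h0V rfl)
  obtain ⟨h₀, hh₀, hball⟩ := Metric.isOpen_iff.1 hI 0 h0I
  obtain ⟨ρ, hρ, hρ0, hρ1, hρN⟩ := exists_trig_kernel hN h0N
    (ε := ε / 2 / (2 * |C| + 1)) (by positivity)
  have hWnear : ∀ p q : ℝ × BohrCompact d, q.1 ∈ Set.Icc α β → |p.1 - q.1| < h₀ →
      p.2 - q.2 ∈ N → |W p - W q| ≤ ε / 2 := by
    intro p q hq ht hx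
    have h1 : (p.1 - q.1, p.2 - q.2) ∈ V := hIN ⟨hball (by simpa using ht), hx⟩
    have h2 := hUV (Set.mk_mem_prod (hKU ⟨hq, trivial⟩) h1)
    have h3 : q + (p.1 - q.1, p.2 - q.2) = p := by ext <;> simp
    simp only [Set.mem_ofPred_eq, h3] at h2
    exact h2.le
  refine ⟨ρ, hρ, hρ0, hρ1, h₀, hh₀, fun h hh κ hκ => ?_⟩
  filter_upwards [ae_slab_fst_mem] with q hq
  -- Majorant of the oscillation times ρ: at most ε/2 for displacements in `N`, and the crude bound
  -- 2|C| outside, where ρ has mass at most ε/2/(2|C| + 1).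
  set f : BohrCompact d → ℝ := fun w => ε / 2 * ρ w + 2 * |C| * Nᶜ.indicator ρ w with hf
  have hρi := integrable_of_continuous hρ.continuous
  have hρNi : Integrable (Nᶜ.indicator ρ) (haar d) := hρi.indicator hN.isClosed_compl.measurableSet
  have hfi : Integrable f (haar d) := (hρi.const_mul _).add (hρNi.const_mul _)
  have hfint : ∫ w, f w ∂(haar d) ≤ ε := by
    rw [hf, integral_add (hρi.const_mul _) (hρNi.const_mul _), integral_const_mul,
      integral_const_mul, hρ1, integral_indicator hN.isClosed_compl.measurableSet]
    calc ε / 2 * 1 + 2 * |C| * ∫ w in Nᶜ, ρ w ∂(haar d)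
        ≤ ε / 2 * 1 + (2 * |C| + 1) * (ε / 2 / (2 * |C| + 1)) := by
          refine add_le_add le_rfl (mul_le_mul (by linarith) hρN ?_ (by positivity))
          exact integral_nonneg fun w => hρ0 w
      _ = ε := by field_simp; ring
  have hf0 : 0 ≤ ∫ w, f w ∂(haar d) := integral_nonneg fun w =>
    add_nonneg (mul_nonneg (half_pos hε).le (hρ0 w))
      (mul_nonneg (by positivity) (Set.indicator_nonneg (fun w _ => hρ0 w) w))
  have hR : Integrable (fun p => kernel (fun t s => κ (t - s)) f (p, q)) (slab d α β) :=
    ((hκ.integrable.comp_sub_right q.1).restrict).mul_prod (hfi.comp_sub_right q.2)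
  have hcont : Continuous fun p : ℝ × BohrCompact d =>
      |W p - W q| * kernel (fun t s => κ (t - s)) ρ (p, q) := by
    have := hκ.continuous
    have := hρ.continuous
    unfold kernel
    fun_prop
  calc ∫ p, |W p - W q| * kernel (fun t s => κ (t - s)) ρ (p, q) ∂(slab d α β)
      ≤ ∫ p, kernel (fun t s => κ (t - s)) f (p, q) ∂(slab d α β) := by
        refine integral_mono_ae (integrable_slab_of_continuous hcont) hR ?_
        filter_upwards [ae_slab_fst_mem] with p hp
        by_cases ht : |p.1 - q.1| < h₀
        · have hκ0 := hκ.nonneg (p.1 - q.1)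
          have hρ0' := hρ0 (p.2 - q.2)
          have key : |W p - W q| * ρ (p.2 - q.2) ≤ f (p.2 - q.2) := by
            simp only [hf]
            by_cases hx : p.2 - q.2 ∈ N
            · rw [Set.indicator_of_notMem (Set.notMem_compl_iff.2 hx), mul_zero, add_zero]
              exact mul_le_mul_of_nonneg_right (hWnear p q hq ht hx) hρ0'
            · rw [Set.indicator_of_mem (show p.2 - q.2 ∈ Nᶜ from hx)]
              have h1 : |W p - W q| ≤ 2 * |C| :=
                (abs_sub _ _).trans (by linarith [hC' p hp, hC' q hq])
              nlinarith [mul_le_mul_of_nonneg_right h1 hρ0', mul_nonneg hε.le hρ0']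
          calc |W p - W q| * kernel (fun t s => κ (t - s)) ρ (p, q)
              = κ (p.1 - q.1) * (|W p - W q| * ρ (p.2 - q.2)) := by simp only [kernel]; ring
            _ ≤ _ := mul_le_mul_of_nonneg_left key hκ0
        · simp only [kernel]
          rw [hκ.supp _ (hh.trans (not_lt.1 ht))]
          simp
    _ ≤ 1 * ε := by
        rw [integral_kernel_fst]
        exact mul_le_mul (hκ.setIntegral_sub_right_le _ _) hfint hf0 zero_le_one
    _ = ε := one_mul ε

/-- Mollification converges in `L¹` of a slab. -/
theorem exists_mollification {M : ℝ} {v : ℝ × BohrCompact d → ℝ} (hv : IsBoundedOn α β M v)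
    {ε : ℝ} (hε : 0 < ε) :
    ∃ ρ : BohrCompact d → ℝ, IsTrig ρ ∧ (∀ w, 0 ≤ ρ w) ∧ ∫ w, ρ w ∂(haar d) = 1 ∧
      ∃ h₀ > 0, ∀ h ≤ h₀, ∀ κ, IsMollifier h κ →
        pairing α β v v (fun r s => |r - s|) (fun t s => κ (t - s)) ρ ≤ ε := by
  obtain ⟨W, hW, hvW⟩ := isContApprox_of_integrable hv.integrable (ε / 3) (by positivity)
  set m := (slab d α β).real Set.univ with hm
  obtain ⟨ρ, hρ, hρ0, hρ1, h₀, hh₀, H⟩ := exists_continuous_mollification (α := α) (β := β) hW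
    (ε := ε / 3 / (m + 1)) (by positivity)
  refine ⟨ρ, hρ, hρ0, hρ1, h₀, hh₀, fun h hh κ hκ => ?_⟩
  have hWi := integrable_slab_of_continuous (α := α) (β := β) hW
  have hD : Integrable (fun p => |v p - W p|) (slab d α β) := (hv.integrable.sub hWi).abs
  have hDn : ∀ p, 0 ≤ |v p - W p| := fun p => abs_nonneg _
  have hkn : ∀ z : (ℝ × BohrCompact d) × (ℝ × BohrCompact d),
      0 ≤ kernel (fun t s => κ (t - s)) ρ z := fun z => mul_nonneg (hκ.nonneg _) (hρ0 _)
  have j0 := integrable_kernel hv hv (continuous_sub_comp continuous_abs) hκ.continuous_kernel hρ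
  have j1 : Integrable (fun z : (ℝ × BohrCompact d) × (ℝ × BohrCompact d) =>
      |v z.1 - W z.1| * kernel (fun t s => κ (t - s)) ρ z) (slab₂ d α β) :=
    integrable_mul_kernel (hD.comp_fst _) hκ.continuous_kernel hρ
  have j2 : Integrable (fun z : (ℝ × BohrCompact d) × (ℝ × BohrCompact d) =>
      |W z.1 - W z.2| * kernel (fun t s => κ (t - s)) ρ z) (slab₂ d α β) :=
    integrable_mul_kernel ((hWi.comp_fst _).sub (hWi.comp_snd _)).abs hκ.continuous_kernel hρ
  have j3 : Integrable (fun z : (ℝ × BohrCompact d) × (ℝ × BohrCompact d) =>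
      |v z.2 - W z.2| * kernel (fun t s => κ (t - s)) ρ z) (slab₂ d α β) :=
    integrable_mul_kernel (hD.comp_snd _) hκ.continuous_kernel hρ
  have b1 : ∫ z, |v z.1 - W z.1| * kernel (fun t s => κ (t - s)) ρ z ∂(slab₂ d α β) ≤ ε / 3 := by
    unfold slab₂ at j1 ⊢
    rw [integral_prod _ j1]
    refine le_trans (integral_mono j1.integral_prod_left hD fun p => ?_) hvW
    simp only
    rw [integral_const_mul, integral_kernel_snd p hρ1]
    exact mul_le_of_le_one_right (hDn p) (hκ.setIntegral_sub_left_le _ _)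
  have b3 : ∫ z, |v z.2 - W z.2| * kernel (fun t s => κ (t - s)) ρ z ∂(slab₂ d α β) ≤ ε / 3 := by
    unfold slab₂ at j3 ⊢
    rw [integral_prod_symm _ j3]
    refine le_trans (integral_mono j3.integral_prod_right hD fun q => ?_) hvW
    simp only
    rw [integral_const_mul, integral_kernel_fst q, hρ1, mul_one]
    exact mul_le_of_le_one_right (hDn q) (hκ.setIntegral_sub_right_le _ _)
  have b2 : ∫ z, |W z.1 - W z.2| * kernel (fun t s => κ (t - s)) ρ z ∂(slab₂ d α β) ≤ ε / 3 := by
    unfold slab₂ at j2 ⊢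
    rw [integral_prod_symm _ j2]
    refine (integral_mono_ae j2.integral_prod_right
      (integrable_const (ε / 3 / (m + 1))) (H h hh κ hκ)).trans ?_
    rw [integral_const, smul_eq_mul, ← hm]
    calc m * (ε / 3 / (m + 1)) ≤ (m + 1) * (ε / 3 / (m + 1)) := by gcongr; linarith
      _ = ε / 3 := by
        have : 0 < m + 1 := by positivity
        field_simp
  have j12 : Integrable (fun z : (ℝ × BohrCompact d) × (ℝ × BohrCompact d) =>
      |v z.1 - W z.1| * kernel (fun t s => κ (t - s)) ρ z +
      |W z.1 - W z.2| * kernel (fun t s => κ (t - s)) ρ z) (slab₂ d α β) := j1.add j2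
  calc pairing α β v v (fun r s => |r - s|) (fun t s => κ (t - s)) ρ
      ≤ ∫ z, (|v z.1 - W z.1| * kernel (fun t s => κ (t - s)) ρ z +
          |W z.1 - W z.2| * kernel (fun t s => κ (t - s)) ρ z +
          |v z.2 - W z.2| * kernel (fun t s => κ (t - s)) ρ z) ∂(slab₂ d α β) := by
        refine integral_mono j0 (j12.add j3) fun z => ?_
        simp only [← add_mul]
        refine mul_le_mul_of_nonneg_right ?_ (hkn z)
        calc |v z.1 - v z.2| ≤ |v z.1 - W z.1| + |W z.1 - v z.2| := abs_sub_le _ _ _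
          _ ≤ |v z.1 - W z.1| + (|W z.1 - W z.2| + |W z.2 - v z.2|) := by
              gcongr; exact abs_sub_le _ _ _
          _ = _ := by rw [abs_sub_comm (W z.2), add_assoc]
    _ ≤ ε := by
        rw [integral_add j12 j3, integral_add j1 j2]
        linarith

end

/-! ### The contraction property in time -/

/-- The `L¹` distance of two solutions decreases in time, in the sense of distributions. -/
theorem IsSlabSolution.integral_mul_deriv_nonneg {P : Coefficients d} {M : ℝ}
    {u v : ℝ × BohrCompact d → ℝ} {g h : Fin d → ℝ × BohrCompact d → ℝ}
    (hs : IsSlabSolution P α β u g) (hs' : IsSlabSolution P α β v h)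
    (hu : IsBoundedOn α β M u) (hv : IsBoundedOn α β M v) {θ : ℝ → ℝ} (hθ : ContDiff ℝ ∞ θ)
    (hθ0 : ∀ t, 0 ≤ θ t) {r : ℝ} (hr : 0 < r)
    (hθs : ∀ t, t ∉ Set.Icc (α + r) (β - r) → θ t = 0) :
    0 ≤ ∫ p, |u p - v p| * deriv θ p.1 ∂(slab d α β) := by
  have hθ'c : Continuous (deriv θ) := hθ.continuous_deriv (by simp)
  obtain ⟨C, hC⟩ := (isCompact_Icc (a := α + r) (b := β - r)).exists_bound_of_continuousOn
    hθ'c.continuousOn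
  have hθ's : ∀ t, t ∉ Set.Icc (α + r) (β - r) → deriv θ t = 0 := fun t ht =>
    deriv_eq_zero_of_forall_notMem hθs ht
  have hC' : ∀ t, |deriv θ t| ≤ |C| := fun t => by
    by_cases ht : t ∈ Set.Icc (α + r) (β - r)
    · exact (hC t ht).trans (le_abs_self _)
    · rw [hθ's t ht, abs_zero]; exact abs_nonneg _
  refine le_of_forall_pos_le_add fun ε hε => ?_
  obtain ⟨ρ, hρ, hρ0, hρ1, h₀, hh₀, H⟩ := exists_mollification hv
    (ε := ε / (|C| + 1)) (by positivity)
  -- Width below `h₀` controls the mollification error; width at most `r` keeps the kernel inside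
  -- the slab in `s` and gives it full mass wherever θ' is nonzero.
  obtain ⟨κ, hκ⟩ := exists_isMollifier (lt_min hh₀ hr)
  have hE := H _ (min_le_left _ _) κ hκ
  have hκc := hκ.continuous
  have hκ'c : Continuous (deriv κ) := hκ.smooth.continuous_deriv (by simp)
  have hκd : ∀ t, HasDerivAt κ (deriv κ t) t := fun t =>
    (hκ.smooth.differentiable (by simp) t).hasDerivAt
  have hθd : ∀ t, HasDerivAt θ (deriv θ t) t := fun t =>
    (hθ.differentiable (by simp) t).hasDerivAt
  have hθc := hθ.continuous
  have hτ : IsTimeKernel α β (fun t s => θ t * κ (t - s))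
      (fun t s => deriv θ t * κ (t - s) + θ t * deriv κ (t - s)) :=
    { cont := by simp only [Function.uncurry_def]; fun_prop
      cont₁ := by simp only [Function.uncurry_def]; fun_prop
      nonneg := fun t s => mul_nonneg (hθ0 t) (hκ.nonneg _)
      smooth := fun s => hθ.mul (hκ.smooth.comp (contDiff_id.sub contDiff_const))
      deriv_eq := fun t s => ((hθd t).mul ((hκd (t - s)).comp_sub_const t s)).deriv
      supp := fun t s ht => by
        rw [hθs t fun h => ht ⟨by linarith [h.1], by linarith [h.2]⟩, zero_mul] }
  have hτ' : IsTimeKernel α β (fun s t => θ t * κ (t - s))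
      (fun s t => -(θ t * deriv κ (t - s))) :=
    { cont := by simp only [Function.uncurry_def]; fun_prop
      cont₁ := by simp only [Function.uncurry_def]; fun_prop
      nonneg := fun s t => mul_nonneg (hθ0 t) (hκ.nonneg _)
      smooth := fun t => contDiff_const.mul (hκ.smooth.comp (contDiff_const.sub contDiff_id))
      deriv_eq := fun s t => by
        have := (((hκd (t - s)).comp_const_sub t s).const_mul (θ t)).deriv
        rw [this]
        ring
      supp := fun s t hst => by
        by_cases ht : t ∈ Set.Icc (α + r) (β - r)
        · rw [hκ.supp, mul_zero]
          refine (min_le_right _ _).trans ?_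
          by_contra! hlt
          rw [abs_lt] at hlt
          exact hst ⟨by linarith [ht.1], by linarith [ht.2]⟩
        · rw [hθs t ht, zero_mul] }
  have hk := hs.kruzhkov hs' hu hv hτ (τ₂ := fun t s => -(θ t * deriv κ (t - s))) hτ' hρ hρ0
  have hτ₂ : Continuous (Function.uncurry fun t s => -(θ t * deriv κ (t - s))) := by
    simp only [Function.uncurry_def]; fun_prop
  have hτ₃ : Continuous (Function.uncurry fun t s => deriv θ t * κ (t - s)) := by
    simp only [Function.uncurry_def]; fun_prop
  have hcabs := continuous_sub_comp continuous_abs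
  -- The derivatives of κ(t - s) in t and s cancel, and only θ' survives.
  have hsum : pairing α β u v (fun r s => |r - s|)
      (fun t s => deriv θ t * κ (t - s) + θ t * deriv κ (t - s)) ρ
      + pairing α β u v (fun r s => |r - s|) (fun t s => -(θ t * deriv κ (t - s))) ρ =
      pairing α β u v (fun r s => |r - s|) (fun t s => deriv θ t * κ (t - s)) ρ := by
    unfold pairing
    rw [← integral_add (integrable_kernel hu hv hcabs hτ.cont₁ hρ)
      (integrable_kernel hu hv hcabs hτ₂ hρ)]
    congr 1
    funext z
    simp only [kernel]
    ring
  rw [hsum] at hk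
  have hD : Integrable (fun p => |u p - v p| * deriv θ p.1) (slab d α β) :=
    (hu.integrable.sub hv.integrable).abs.mul_bdd (c := |C|)
      (hθ'c.comp continuous_fst).measurable.aestronglyMeasurable
      (Eventually.of_forall fun p => hC' _)
  have j0 := integrable_kernel hu hv hcabs hτ₃ hρ
  have j1 : Integrable (fun z : (ℝ × BohrCompact d) × (ℝ × BohrCompact d) =>
      |u z.1 - v z.1| * deriv θ z.1.1 * kernel (fun t s => κ (t - s)) ρ z) (slab₂ d α β) :=
    integrable_mul_kernel (hD.comp_fst _) hκ.continuous_kernel hρ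
  have j2 := (integrable_kernel hv hv hcabs hκ.continuous_kernel hρ).const_mul |C|
  have e1 : ∫ z, |u z.1 - v z.1| * deriv θ z.1.1 * kernel (fun t s => κ (t - s)) ρ z
      ∂(slab₂ d α β) = ∫ p, |u p - v p| * deriv θ p.1 ∂(slab d α β) := by
    unfold slab₂ at j1 ⊢
    rw [integral_prod _ j1]
    congr 1
    funext p
    simp only
    rw [integral_const_mul, integral_kernel_snd p hρ1]
    by_cases ht : p.1 ∈ Set.Icc (α + r) (β - r)
    · rw [hκ.setIntegral_sub_left_eq, mul_one]
      have := min_le_right h₀ r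
      exact ⟨by linarith [ht.1], by linarith [ht.2]⟩
    · rw [hθ's _ ht]
      ring
  calc 0 ≤ pairing α β u v (fun r s => |r - s|) (fun t s => deriv θ t * κ (t - s)) ρ := hk
    _ ≤ ∫ z, (|u z.1 - v z.1| * deriv θ z.1.1 * kernel (fun t s => κ (t - s)) ρ z +
          |C| * (|v z.1 - v z.2| * kernel (fun t s => κ (t - s)) ρ z)) ∂(slab₂ d α β) := by
        refine integral_mono j0 (j1.add j2) fun z => ?_
        have hk0 : 0 ≤ kernel (fun t s => κ (t - s)) ρ z := mul_nonneg (hκ.nonneg _) (hρ0 _)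
        -- Moving `v` from (s,y) to (t,x) is the only replacement needed, so ρ and κ were adapted to
        -- `v` alone.
        have h1 : |(|u z.1 - v z.2| - |u z.1 - v z.1|)| ≤ |v z.1 - v z.2| := by
          refine (abs_abs_sub_abs_le_abs_sub _ _).trans (le_of_eq ?_)
          congr 1
          ring
        have h2 : (|u z.1 - v z.2| - |u z.1 - v z.1|) * deriv θ z.1.1 ≤
            |C| * |v z.1 - v z.2| := by
          refine (le_abs_self _).trans ?_
          rw [abs_mul, mul_comm]
          exact mul_le_mul (hC' _) h1 (abs_nonneg _) (abs_nonneg _)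
        have h3 := mul_le_mul_of_nonneg_right h2 hk0
        simp only [kernel] at h3 ⊢
        linarith
    _ = ∫ p, |u p - v p| * deriv θ p.1 ∂(slab d α β) +
          |C| * pairing α β v v (fun r s => |r - s|) (fun t s => κ (t - s)) ρ := by
        rw [integral_add j1 j2, e1, integral_const_mul]
        rfl
    _ ≤ ∫ p, |u p - v p| * deriv θ p.1 ∂(slab d α β) + ε := by
        refine add_le_add le_rfl ?_
        calc |C| * pairing α β v v (fun r s => |r - s|) (fun t s => κ (t - s)) ρ
            ≤ |C| * (ε / (|C| + 1)) := mul_le_mul_of_nonneg_left hE (abs_nonneg _)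
          _ ≤ (|C| + 1) * (ε / (|C| + 1)) := by gcongr; linarith
          _ = ε := by field_simp

/-- A smoothed indicator function of `[t₁, t₂]`. -/
theorem IsMollifier.exists_step {h : ℝ} {κ : ℝ → ℝ} (hκ : IsMollifier h κ) {t₁ t₂ : ℝ}
    (h12 : t₁ ≤ t₂) :
    ∃ θ : ℝ → ℝ, ContDiff ℝ ∞ θ ∧ (∀ t, 0 ≤ θ t) ∧
      (∀ t, deriv θ t = κ (t - t₁) - κ (t - t₂)) ∧
      ∀ t, t ∉ Set.Icc (t₁ - h) (t₂ + h) → θ t = 0 := by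
  set Φ : ℝ → ℝ := fun t => ∫ r in (-h)..t, κ r with hΦ
  have hi : ∀ a b, IntervalIntegrable κ volume a b := fun a b =>
    hκ.continuous.intervalIntegrable a b
  have hd : ∀ t, HasDerivAt Φ (κ t) t := fun t =>
    intervalIntegral.integral_hasDerivAt_right (hi _ _)
      hκ.continuous.stronglyMeasurable.stronglyMeasurableAtFilter hκ.continuous.continuousAt
  have hΦs : ContDiff ℝ ∞ Φ := by
    refine contDiff_infty_iff_deriv.2 ⟨fun t => (hd t).differentiableAt, ?_⟩
    rw [show deriv Φ = κ from funext fun t => (hd t).deriv]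
    exact hκ.smooth
  have hsub : ∀ a b, Φ b - Φ a = ∫ r in a..b, κ r := fun a b =>
    intervalIntegral.integral_interval_sub_left (hi _ _) (hi _ _)
  have hzero : ∀ a b, a ≤ b → (∀ r ∈ Set.Icc a b, h ≤ |r|) → Φ b = Φ a := by
    intro a b hab H
    rw [← sub_eq_zero, hsub]
    rw [intervalIntegral.integral_congr (g := fun _ => 0), intervalIntegral.integral_zero]
    intro r hr
    rw [Set.uIcc_of_le hab] at hr
    exact hκ.supp r (H r hr)
  refine ⟨fun t => Φ (t - t₁) - Φ (t - t₂), ?_, fun t => ?_, fun t => ?_, fun t ht => ?_⟩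
  · exact (hΦs.comp (contDiff_id.sub contDiff_const)).sub
      (hΦs.comp (contDiff_id.sub contDiff_const))
  · simp only [hsub]
    exact intervalIntegral.integral_nonneg (by linarith) fun r _ => hκ.nonneg r
  · exact (((hd (t - t₁)).comp_sub_const t t₁).sub ((hd (t - t₂)).comp_sub_const t t₂)).deriv
  -- Outside the stated interval, [t - t₂, t - t₁] lies entirely on one side of the support of κ.
  · rw [sub_eq_zero]
    refine hzero _ _ (by linarith) fun r hr => ?_
    by_cases h1 : t < t₁ - h
    · rw [le_abs]
      right
      linarith [hr.2]
    · have h2 : t₂ + h < t := by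
        by_contra! h2
        exact ht ⟨not_lt.1 h1, h2⟩
      rw [le_abs]
      left
      linarith [hr.1]

/-! ### Time slices and monotonicity of the L¹ distance -/

theorem exists_ae_bound {u : ℝ × BohrCompact d → ℝ} (hu : MemLp u ⊤ (spaceTime d)) :
    ∃ M, ∀ᵐ p ∂(spaceTime d), |u p| ≤ M := by
  refine ⟨(eLpNorm u ⊤ (spaceTime d)).toReal, ?_⟩
  filter_upwards [ae_le_eLpNormEssSup (f := u) (μ := spaceTime d)] with p hp
  rw [← eLpNorm_exponent_top] at hp
  have := ENNReal.toReal_mono hu.2.ne hp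
  simpa using this

theorem isBoundedOn_of_ae {u : ℝ × BohrCompact d → ℝ} {M α β : ℝ}
    (hu : AEStronglyMeasurable u (spaceTime d)) (hM : ∀ᵐ p ∂(spaceTime d), |u p| ≤ M)
    (hα : 0 < α) : IsBoundedOn α β M u := by
  refine ⟨?_, ?_⟩
  · rw [slab_eq_restrict hα]
    exact hu.restrict
  · rw [slab_eq_restrict hα]
    exact ae_restrict_of_ae hM

/-- The `L¹` distance of two functions at time `t`. -/
noncomputable def sliceDist (u v : ℝ × BohrCompact d → ℝ) (t : ℝ) : ℝ :=
  ∫ w, |u (t, w) - v (t, w)| ∂(haar d)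

theorem ae_integrable_slice {u : ℝ × BohrCompact d → ℝ} (hu : MemLp u ⊤ (spaceTime d)) :
    ∀ᵐ t ∂(volume.restrict (Set.Ioi (0 : ℝ))), Integrable (fun w => u (t, w)) (haar d) := by
  obtain ⟨M, hM⟩ := exists_ae_bound hu
  filter_upwards [hu.1.prodMk_left, Measure.ae_ae_of_ae_prod hM] with t h1 h2
  exact Integrable.of_bound h1 M h2

/-- The `L¹` distance of two entropy solutions is almost everywhere nonincreasing in time. -/
theorem exists_ae_antitone_sliceDist {P : Coefficients d} {u₀ v₀ : BohrCompact d → ℝ}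
    {u v : ℝ × BohrCompact d → ℝ} (hu : IsEntropySolution P u₀ u)
    (hv : IsEntropySolution P v₀ v) :
    ∃ A : Set ℝ, (∀ᵐ t ∂(volume.restrict (Set.Ioi (0 : ℝ))), t ∈ A) ∧
      ∀ t₁ ∈ A, ∀ t₂ ∈ A, 0 < t₁ → t₁ < t₂ → sliceDist u v t₂ ≤ sliceDist u v t₁ := by
  have hum := hu.2.1
  have hvm := hv.2.1
  obtain ⟨Mu, hMu⟩ := exists_ae_bound hum
  obtain ⟨Mv, hMv⟩ := exists_ae_bound hvm
  set M := max Mu Mv with hM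
  have hMu' : ∀ᵐ p ∂(spaceTime d), |u p| ≤ M := hMu.mono fun p hp => hp.trans (le_max_left _ _)
  have hMv' : ∀ᵐ p ∂(spaceTime d), |v p| ≤ M := hMv.mono fun p hp => hp.trans (le_max_right _ _)
  obtain ⟨g, hg⟩ := exists_isSlabSolution hu
  obtain ⟨g', hg'⟩ := exists_isSlabSolution hv
  set G : ℝ → ℝ := (Set.Ioi (0 : ℝ)).indicator (sliceDist u v) with hG
  have hDm : AEStronglyMeasurable (sliceDist u v) (volume.restrict (Set.Ioi (0 : ℝ))) :=
    AEStronglyMeasurable.integral_prod_right' (f := fun p => |u p - v p|)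
      (hum.1.sub hvm.1).norm
  have hDb : ∀ᵐ t ∂(volume.restrict (Set.Ioi (0 : ℝ))), |sliceDist u v t| ≤ 2 * M := by
    have : ∀ᵐ p ∂(spaceTime d), |u p - v p| ≤ 2 * M := by
      filter_upwards [hMu', hMv'] with p h1 h2
      exact (abs_sub _ _).trans (by linarith)
    filter_upwards [Measure.ae_ae_of_ae_prod this] with t ht
    have h := norm_integral_le_of_norm_le_const (μ := haar d)
      (f := fun w => |u (t, w) - v (t, w)|) (C := 2 * M) (by simpa using ht)
    simpa [sliceDist] using h
  have hGm : AEStronglyMeasurable G volume :=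
    (aestronglyMeasurable_indicator_iff measurableSet_Ioi).2 hDm
  have hGb : ∀ᵐ t, ‖G t‖ ≤ |2 * M| := by
    filter_upwards [(ae_restrict_iff' measurableSet_Ioi).1 hDb] with t ht
    by_cases h0 : t ∈ Set.Ioi (0 : ℝ)
    · rw [hG, Set.indicator_of_mem h0]
      exact (ht h0).trans (le_abs_self _)
    · rw [hG, Set.indicator_of_notMem h0, norm_zero]
      exact abs_nonneg _
  have hGl : LocallyIntegrable G volume :=
    (memLp_top_of_bound hGm _ hGb).locallyIntegrable le_top
  set φ : ℕ → ContDiffBump (0 : ℝ) := fun n =>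
    ⟨1 / ((n : ℝ) + 1) / 2, 1 / ((n : ℝ) + 1), by positivity, half_lt_self (by positivity)⟩ with hφ
  have hφlim : Tendsto (fun n => (φ n).rOut) atTop (𝓝 0) := tendsto_one_div_add_atTop_nhds_zero_nat
  have hconv := ContDiffBump.ae_convolution_tendsto_right_of_locallyIntegrable (μ := volume)
    (K := 2) hφlim (Eventually.of_forall fun n => by simp only [hφ]; linarith) hGl
  -- The good times are those at which the mollifications of the L¹ distance converge to its value;
  -- almost every time qualifies. Fixing this set in advance allows comparing any two of its
  -- members.
  refine ⟨{t | Tendsto (fun n => MeasureTheory.convolution ((φ n).normed volume) G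
    (ContinuousLinearMap.lsmul ℝ ℝ) volume t) atTop (𝓝 (G t))}, ae_restrict_of_ae hconv, ?_⟩
  intro t₁ ht₁ t₂ ht₂ h0 h12
  have hG1 : ∀ t, 0 < t → G t = sliceDist u v t := fun t ht =>
    Set.indicator_of_mem (s := Set.Ioi 0) ht _
  rw [← hG1 t₁ h0, ← hG1 t₂ (h0.trans h12)]
  refine le_of_tendsto_of_tendsto ht₂ ht₁ ?_
  -- Radius `r < t₁/4` makes `t₁ - 2 * r` positive. The slab extends `2 * r` beyond [t₁, t₂]: one
  -- `r` for the support of θ, one for the margin required by the contraction inequality.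
  filter_upwards [hφlim.eventually (gt_mem_nhds (half_pos (half_pos h0)))] with n hn
  have hκ := isMollifier_normed (φ n)
  set κ := (φ n).normed volume with hκdef
  set r := (φ n).rOut with hr
  have hr0 : 0 < r := (φ n).rOut_pos
  have hcv : ∀ t, MeasureTheory.convolution κ G (ContinuousLinearMap.lsmul ℝ ℝ) volume t =
      ∫ s, G s * κ (s - t) := fun t => by
    rw [convolution_eq_swap]
    congr 1
    funext s
    rw [ContinuousLinearMap.lsmul_apply, smul_eq_mul, mul_comm, ← hκ.even, neg_sub]
  rw [hcv, hcv]
  have hint : ∀ t, Integrable fun s => G s * κ (s - t) := fun t =>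
    (hκ.integrable.comp_sub_right t).bdd_mul hGm hGb
  obtain ⟨θ, hθ, hθ0, hθd, hθs⟩ := hκ.exists_step h12.le
  have hα : 0 < t₁ - 2 * r := by linarith
  have key := (hg (t₁ - 2 * r) (t₂ + 2 * r) hα).integral_mul_deriv_nonneg (hg' _ _ hα)
    (isBoundedOn_of_ae hum.1 hMu' hα) (isBoundedOn_of_ae hvm.1 hMv' hα) hθ hθ0 hr0
    (fun t ht => hθs t fun h => ht ⟨by linarith [h.1], by linarith [h.2]⟩)
  have hθ'c : Continuous (deriv θ) := hθ.continuous_deriv (by simp)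
  have hθ's : ∀ t, t ∉ Set.Icc (t₁ - r) (t₂ + r) → deriv θ t = 0 := fun t ht =>
    deriv_eq_zero_of_forall_notMem hθs ht
  obtain ⟨C, hC⟩ := (isCompact_Icc (a := t₁ - 2 * r) (b := t₂ + 2 * r)).exists_bound_of_continuousOn
    hθ'c.continuousOn
  have hI : Integrable (fun p => |u p - v p| * deriv θ p.1)
      (slab d (t₁ - 2 * r) (t₂ + 2 * r)) := by
    refine ((isBoundedOn_of_ae hum.1 hMu' hα).integrable.sub
      (isBoundedOn_of_ae hvm.1 hMv' hα).integrable).abs.mul_bdd (c := C)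
      (hθ'c.comp continuous_fst).measurable.aestronglyMeasurable ?_
    filter_upwards [ae_slab_fst_mem] with p hp using hC _ hp
  have e1 : ∫ p, |u p - v p| * deriv θ p.1 ∂(slab d (t₁ - 2 * r) (t₂ + 2 * r)) =
      ∫ s, (G s * κ (s - t₁) - G s * κ (s - t₂)) := by
    unfold slab at hI ⊢
    rw [integral_prod _ hI]
    simp only [integral_mul_const]
    refine Eq.trans ?_ (setIntegral_eq_integral_of_forall_compl_eq_zero
      (s := Set.Icc (t₁ - 2 * r) (t₂ + 2 * r)) ?_)
    · refine setIntegral_congr_fun measurableSet_Icc fun t ht => ?_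
      rw [hG1 t (hα.trans_le ht.1), hθd, ← mul_sub]
      rfl
    · intro t ht
      rw [← mul_sub, ← hθd, hθ's t fun h => ht ⟨by linarith [h.1], by linarith [h.2]⟩, mul_zero]
  rw [e1, integral_sub (hint _) (hint _)] at key
  linarith

/-! ### Passage to the initial time -/

/-- Every right neighbourhood of 0 has positive measure, so an essential limit at 0+ has content and
inequalities pass to it. -/
instance neBot_nhdsGT_inf_ae : NeBot (𝓝[>] (0 : ℝ) ⊓ ae volume) := by
  rw [inf_neBot_iff_frequently_left]
  intro p hp
  rw [frequently_ae_iff]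
  obtain ⟨b, hb, hbp⟩ := mem_nhdsGT_iff_exists_Ioo_subset.1 hp
  have : 0 < volume (Set.Ioo (0 : ℝ) b) := by
    rw [Real.volume_Ioo]
    simpa using hb
  exact (this.trans_le (measure_mono hbp)).ne'

/-- The `L¹` contraction property of entropy solutions. -/
theorem ae_sliceDist_le {P : Coefficients d} {u₀ v₀ : BohrCompact d → ℝ}
    {u v : ℝ × BohrCompact d → ℝ} (hu : IsEntropySolution P u₀ u)
    (hv : IsEntropySolution P v₀ v) :
    ∀ᵐ t ∂(volume.restrict (Set.Ioi (0 : ℝ))),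
      sliceDist u v t ≤ ∫ w, |u₀ w - v₀ w| ∂(haar d) := by
  obtain ⟨A, hA, hmono⟩ := exists_ae_antitone_sliceDist hu hv
  filter_upwards [hA, ae_restrict_mem measurableSet_Ioi] with t ht ht0
  have hu0 : Integrable u₀ (haar d) := hu.1.integrable le_top
  have hv0 : Integrable v₀ (haar d) := hv.1.integrable le_top
  have hlim : Tendsto (fun s => ∫ w, |u (s, w) - u₀ w| ∂(haar d) + ∫ w, |u₀ w - v₀ w| ∂(haar d) +
      ∫ w, |v (s, w) - v₀ w| ∂(haar d)) (𝓝[>] (0 : ℝ) ⊓ ae volume)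
      (𝓝 (0 + ∫ w, |u₀ w - v₀ w| ∂(haar d) + 0)) :=
    (hu.2.2.2.add_const _).add hv.2.2.2
  rw [zero_add, add_zero] at hlim
  refine ge_of_tendsto hlim ?_
  have hgt : ∀ᶠ s in 𝓝[>] (0 : ℝ) ⊓ ae volume, s ∈ Set.Ioo 0 t :=
    (show 𝓝[>] (0 : ℝ) ⊓ ae volume ≤ 𝓝[>] 0 from inf_le_left) (Ioo_mem_nhdsGT ht0)
  have hae : ∀ {p : ℝ → Prop}, (∀ᵐ s ∂(volume.restrict (Set.Ioi (0 : ℝ))), p s) →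
      ∀ᶠ s in 𝓝[>] (0 : ℝ) ⊓ ae volume, s ∈ Set.Ioi (0 : ℝ) → p s := fun h =>
    (show 𝓝[>] (0 : ℝ) ⊓ ae volume ≤ ae volume from inf_le_right)
      ((ae_restrict_iff' measurableSet_Ioi).1 h)
  filter_upwards [hgt, hae hA, hae (ae_integrable_slice hu.2.1),
    hae (ae_integrable_slice hv.2.1)] with s hs h1 h2 h3
  have i1 : Integrable (fun w => |u (s, w) - u₀ w|) (haar d) := ((h2 hs.1).sub hu0).abs
  have i2 : Integrable (fun w => |u₀ w - v₀ w|) (haar d) := (hu0.sub hv0).abs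
  have i3 : Integrable (fun w => |v (s, w) - v₀ w|) (haar d) := ((h3 hs.1).sub hv0).abs
  have i12 : Integrable (fun w => |u (s, w) - u₀ w| + |u₀ w - v₀ w|) (haar d) := i1.add i2
  -- Monotonicity moves the estimate from `t` to an arbitrarily early good time `s`, where u(s) and
  -- v(s) are compared with the initial functions.
  refine (hmono s (h1 hs.1) t ht hs.1 hs.2).trans ?_
  calc sliceDist u v s ≤ ∫ w, (|u (s, w) - u₀ w| + |u₀ w - v₀ w| + |v (s, w) - v₀ w|)
        ∂(haar d) := by
        refine integral_mono ((h2 hs.1).sub (h3 hs.1)).abs (i12.add i3) fun w => ?_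
        simp only
        rw [abs_sub_comm (v (s, w))]
        exact (abs_sub_le _ (v₀ w) _).trans (add_le_add (abs_sub_le _ _ _) le_rfl)
    _ = _ := by
        rw [integral_add i12 i3, integral_add i1 i2]

/-- Two entropy solutions with the same initial function coincide almost everywhere. -/
theorem IsEntropySolution.ae_eq {P : Coefficients d} {u₀ : BohrCompact d → ℝ}
    {u v : ℝ × BohrCompact d → ℝ} (hu : IsEntropySolution P u₀ u)
    (hv : IsEntropySolution P u₀ v) : u =ᵐ[spaceTime d] v := by
  have hm : AEStronglyMeasurable (fun p => u p - v p) (spaceTime d) := hu.2.1.1.sub hv.2.1.1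
  have hme : AEMeasurable (fun p => ‖u p - v p‖ₑ) (spaceTime d) := hm.enorm
  -- By Tonelli, vanishing of the L¹ distance on almost every slice gives equality almost everywhere
  -- in space-time.
  have h0 : ∫⁻ p, ‖u p - v p‖ₑ ∂(spaceTime d) = 0 := by
    unfold spaceTime at hme ⊢
    rw [lintegral_prod _ hme]
    refine lintegral_eq_zero_of_ae_eq_zero ?_
    filter_upwards [ae_sliceDist_le hu hv, ae_integrable_slice hu.2.1,
      ae_integrable_slice hv.2.1] with t h1 h2 h3
    simp only [sub_self, abs_zero, integral_zero] at h1
    have h4 := ofReal_integral_norm_eq_lintegral_enorm (h2.sub h3)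
    simp only [Pi.sub_apply, Pi.zero_apply] at h4 ⊢
    rw [← h4]
    exact ENNReal.ofReal_of_nonpos h1
  filter_upwards [(lintegral_eq_zero_iff' hme).1 h0] with p hp
  simpa [sub_eq_zero] using hp

end BohrParabolic

theorem theorem3p2 (d : ℕ) (P : BohrParabolic.Coefficients d) :
    (∀ (u₀ : BohrParabolic.BohrCompact d → ℝ) (u v : ℝ × BohrParabolic.BohrCompact d → ℝ),
      BohrParabolic.IsEntropySolution P u₀ u → BohrParabolic.IsEntropySolution P u₀ v →
        u =ᵐ[BohrParabolic.spaceTime d] v) ∧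
    (∀ (u₀ v₀ : BohrParabolic.BohrCompact d → ℝ) (u v : ℝ × BohrParabolic.BohrCompact d → ℝ),
      BohrParabolic.IsEntropySolution P u₀ u → BohrParabolic.IsEntropySolution P v₀ v →
        ∀ᵐ t ∂(volume.restrict (Set.Ioi (0 : ℝ))),
          ∫ w, |u (t, w) - v (t, w)| ∂(BohrParabolic.haar d) ≤
            ∫ w, |u₀ w - v₀ w| ∂(BohrParabolic.haar d)) :=
  ⟨fun _ _ _ hu hv => hu.ae_eq hv, fun _ _ _ _ hu hv => BohrParabolic.ae_sliceDist_le hu hv⟩
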